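/- For complex $x\neq 0$ and $|p|<1$ let $$\theta(x;p)=\prod_{i\ge 0}(1-xp^i)\Big(1-\frac{p^{i+1}}{x}\Big),\qquad (x;q,p)_k=\prod_{j=0}^{k-1}\theta(xq^j;p),\qquad (x_1,\dots,x_r;q,p)_k=\prod_{i=1}^r (x_i;q,p)_k ,$$ and, for nome $0$, $\theta(x;0)=1-x$, also when $x=0$. Let $n$ be a non-negative integer and let $a,b,q,p$ be complex numbers with $a,b,q\neq 0$ and $|p|<1$, such that none of the factors in the denominators of the following identity vanishes (for $0\le j,k\le n$). Then $$\sum_{j=0}^{n} \frac{\theta(aq^{4j};p^2)\,\big(a,\ a^2q^{2n-2}/b^2,\ q^{-2n},\ b^2q^2/a;\,q^2,p^2\big)_j\,\big(a^2/b^2;q^2,p^4\big)_{2j}\,\big(-bq;q,p\big)_{2j}} {\theta(a;p^2)\,\big(q^2,\ b^2q^{4-2n}/a,\ aq^{2n+2},\ a^2/b^2;\,q^2,p^2\big)_j\,\big(b^2q^2;q^2,p^4\big)_{2j}\,\big(-a/b;q,p\big)_{2j}} \Big(\frac{b^2q^3}{a}\Big)^j$$ $$=\frac{\theta(-a/(bq);p)\,\big(-q,\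 a/(b^2q);\,q,p\big)_n\,\big(aq^2;q^2,p^2\big)_n} {\theta(-aq^{2n-1}/b;p)\,\big(-a/(bq),\ bq;\,q,p\big)_n\,\big(a/(b^2q^2);q^2,p^2\big)_n}\,q^{-n}$$ $$\times\sum_{k=0}^{n} \frac{\theta(b^2q^{4k}p^2;p^4)\,\big(aq^{n-1}/b,\ q^{-n};\,q,p\big)_k\,\big(b^2p^2,\ b^4q^2/a^2;\,q^2,p^4\big)_k} {\theta(b^2p^2;p^4)\,\big(b^2q^{2-n}/a,\ bq^{n+1};\,q,p\big)_k\,\big(q^2,\ a^2p^2/b^2;\,q^2,p^4\big)_k}\,q^{2k}.$$ -/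

import Mathlib

/-- The infinite `q`-shifted factorial `(a; p)_∞ = ∏_{i ≥ 0} (1 - a p^i)`, for `|p| < 1`. -/
noncomputable def qPochInf (a p : ℂ) : ℂ :=
  ∏' i : ℕ, (1 - a * p ^ i)

/-- The modified Jacobi theta function `θ(a; p) = (a; p)_∞ (p/a; p)_∞`, for `a ≠ 0` and `|p| < 1`.
At `p = 0` this is `1 - a`, and this holds for `a = 0` as well. -/
noncomputable def theta (a p : ℂ) : ℂ :=
  qPochInf a p * qPochInf (p / a) p

/-- The theta shifted factorial `(a; q, p)_k = ∏_{j=0}^{k-1} θ(a q^j; p)`. -/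
noncomputable def thetaPoch (a q p : ℂ) (k : ℕ) : ℂ :=
  ∏ j ∈ Finset.range k, theta (a * q ^ j) p

/-- The infinite product defining `(a; p)_∞` converges when `|p| < 1`. -/
theorem multipliable_qPochInf (a : ℂ) {p : ℂ} (hp : ‖p‖ < 1) :
    Multipliable fun i : ℕ => 1 - a * p ^ i := by
  have h : Summable fun i : ℕ => ‖-(a * p ^ i)‖ := by
    simp only [norm_neg, norm_mul, norm_pow]
    exact (summable_geometric_of_lt_one (norm_nonneg p) hp).mul_left _
  simpa [sub_eq_add_neg] using multipliable_one_add_of_summable h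

theorem theta_nome_zero (a : ℂ) : theta a 0 = 1 - a := by
  have h : ∀ x : ℂ, qPochInf x 0 = 1 - x := by
    intro x
    unfold qPochInf
    rw [tprod_eq_mulSingle 0]
    · simp
    · intro i hi
      simp [hi]
  simp [theta, h]

/-!
With `K = a / (bq)` both sides are sums against an elliptic Bailey matrix

  `M(a, k; q, p)_{nj} = (k/a)_{n-j} (k)_{n+j} / ((q)_{n-j} (aq)_{n+j})`.

The left-hand side is `∑_j M(bKq, K²; q², p²)_{nj} α_j`, and the right-hand side is a factor
`θ(-K; p) / θ(-Kq^{2n}; p) q^{-n}` times `∑_k M(b, K; q, p)_{nk} α'_k`, where `α` (`leftSeq`) and `α'`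
(`rightSeq`) are explicit products that do not depend on `n`. Since the Bailey matrix has an explicit
inverse `L` (`sum_baileyM_mul_baileyL`), it suffices to show that

  `α_j = ∑_i L(bKq, K²; q², p²)_{ji} θ(-K; p) / θ(-Kq^{2i}; p) q^{-i} ∑_k M(b, K; q, p)_{ik} α'_k`.

After interchanging the two sums, the sum over `i` is a Frenkel–Turaev sum in base `q` and nome `p`,
because `(x²; q², p²)_m = (x, -x; q, p)_m`; its value is a multiple of `M(b², bKq; q², p²)_{jk}`
(`sum_baileyL_mul_baileyM`). The remaining sum over `k` is a Frenkel–Turaev sum in base `q²` and nome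
`p⁴`, because `(x; q², p²)_m = (x, xp²; q², p⁴)_m` (`sum_baileyM_mul_unit`).

The Frenkel–Turaev sum (`frenkel_turaev`) is proved by induction on its length. Both the recursion of
the summand and that of the value are instances of the Weierstrass addition formula
(`theta_weierstrass`), which holds because, as functions of one variable, its two sides have the same
multiplier under `x ↦ px` and agree at enough points for their difference to vanish.

These steps need `p ≠ 0` and that many theta functions do not vanish. Such parameters are dense
(`mem_closure_genericParameters`), and both sides are continuous in `(a, b, p)` wherever the given
denominators do not vanish, so that the identity extends to all parameters allowed, including `p = 0`.
-/

open Filter Topology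

/-! ### The theta function -/

theorem qPochInf_eq_one_sub_mul (a : ℂ) {p : ℂ} (hp : ‖p‖ < 1) :
    qPochInf a p = (1 - a) * qPochInf (a * p) p := by
  have h := tprod_eq_zero_mul' (f := fun i : ℕ => 1 - a * p ^ i)
    (by simpa [pow_succ', mul_assoc] using multipliable_qPochInf (a * p) hp)
  simpa [qPochInf, pow_succ', mul_assoc] using h

theorem qPochInf_ne_zero {a p : ℂ} (hp : ‖p‖ < 1) (h : ∀ i : ℕ, a * p ^ i ≠ 1) :
    qPochInf a p ≠ 0 := by
  have hs : Summable fun i : ℕ => ‖-(a * p ^ i)‖ := by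
    simp only [norm_neg, norm_mul, norm_pow]
    exact (summable_geometric_of_lt_one (norm_nonneg p) hp).mul_left _
  have := tprod_one_add_ne_zero_of_summable (f := fun i : ℕ => -(a * p ^ i))
    (fun i hi => h i (by linear_combination -hi)) hs
  simpa [qPochInf, sub_eq_add_neg] using this

theorem tendsto_qPochInf {ι : Type*} {l : Filter ι} {f g : ι → ℂ} {a p : ℂ} (hp : ‖p‖ < 1)
    (hf : Tendsto f l (𝓝 a)) (hg : Tendsto g l (𝓝 p)) :
    Tendsto (fun i => qPochInf (f i) (g i)) l (𝓝 (qPochInf a p)) := by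
  obtain ⟨r, hpr, hr⟩ := exists_between hp
  have hr0 : 0 ≤ r := (norm_nonneg p).trans hpr.le
  have := tendsto_tprod_one_add_of_dominated_convergence (𝓕 := l)
    (f := fun i (n : ℕ) => -(f i * g i ^ n)) (g := fun n => -(a * p ^ n))
    (bound := fun n => (‖a‖ + 1) * r ^ n)
    ((summable_geometric_of_lt_one hr0 hr).mul_left _)
    (fun k => (hf.mul (hg.pow k)).neg) (by
      filter_upwards [hf.norm.eventually (gt_mem_nhds (lt_add_one ‖a‖)),
        hg.norm.eventually (gt_mem_nhds hpr)] with i h1 h2 k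
      rw [norm_neg, norm_mul, norm_pow]
      gcongr)
  simpa [qPochInf, sub_eq_add_neg] using this

theorem differentiable_qPochInf {p : ℂ} (hp : ‖p‖ < 1) :
    Differentiable ℂ fun a => qPochInf a p := by
  intro a
  have hu : Summable fun n : ℕ => (‖a‖ + 1) * ‖p‖ ^ n :=
    (summable_geometric_of_lt_one (norm_nonneg p) hp).mul_left _
  have h := Summable.hasProdLocallyUniformlyOn_nat_one_add (f := fun (n : ℕ) (x : ℂ) => -(x * p ^ n))
    (Metric.isOpen_ball (x := (0 : ℂ)) (ε := ‖a‖ + 1)) hu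
    (Eventually.of_forall fun n x hx => by
      rw [norm_neg, norm_mul, norm_pow]
      gcongr
      simpa using (mem_ball_zero_iff.1 hx).le)
    (fun n => by fun_prop)
  have h2 := h.tendstoLocallyUniformlyOn_finsetRange.differentiableOn
    (Eventually.of_forall fun N => by fun_prop) Metric.isOpen_ball
  have h3 := h2.differentiableAt (x := a) (Metric.isOpen_ball.mem_nhds (by simp))
  simpa [qPochInf, sub_eq_add_neg] using h3

theorem theta_eq_one_sub_mul (x : ℂ) {p : ℂ} (hp : ‖p‖ < 1) :
    theta x p = (1 - x) * (qPochInf (x * p) p * qPochInf (p / x) p) := by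
  rw [theta, qPochInf_eq_one_sub_mul x hp, mul_assoc]

theorem theta_one {p : ℂ} (hp : ‖p‖ < 1) : theta 1 p = 0 := by
  simp [theta_eq_one_sub_mul _ hp]

theorem theta_inv {x p : ℂ} (hp : ‖p‖ < 1) (hx : x ≠ 0) :
    theta x⁻¹ p = -x⁻¹ * theta x p := by
  rw [theta_eq_one_sub_mul _ hp, theta_eq_one_sub_mul _ hp, div_inv_eq_mul, mul_comm p x,
    inv_mul_eq_div]
  field_simp
  ring

theorem theta_nome_div {p : ℂ} (hp0 : p ≠ 0) (x : ℂ) : theta (p / x) p = theta x p := by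
  rw [theta, theta, div_div_cancel₀ hp0, mul_comm]

theorem theta_mul_nome {x p : ℂ} (hp : ‖p‖ < 1) (hp0 : p ≠ 0) (hx : x ≠ 0) :
    theta (x * p) p = -x⁻¹ * theta x p := by
  rw [← theta_inv hp hx, ← theta_nome_div hp0 x⁻¹, div_inv_eq_mul, mul_comm]

theorem theta_ne_zero {x p : ℂ} (hp : ‖p‖ < 1) (hp0 : p ≠ 0) (h : ∀ k : ℤ, x ≠ p ^ k) :
    theta x p ≠ 0 := by
  refine mul_ne_zero (qPochInf_ne_zero hp fun i hi => h (-i) ?_)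
    (qPochInf_ne_zero hp fun i hi => h (i + 1) ?_)
  · rw [zpow_neg, zpow_natCast]
    exact eq_inv_of_mul_eq_one_left hi
  · rcases eq_or_ne x 0 with rfl | hx
    · simp at hi
    · rw [zpow_add₀ hp0, zpow_natCast, zpow_one]
      field_simp at hi
      rw [← hi]; ring

/-- `θ(x²; p²) = θ(x; p) θ(-x; p)`. -/
theorem theta_sq {x p : ℂ} (hp : ‖p‖ < 1) :
    theta (x ^ 2) (p ^ 2) = theta x p * theta (-x) p := by
  have key : ∀ a : ℂ, qPochInf (a ^ 2) (p ^ 2) = qPochInf a p * qPochInf (-a) p := by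
    intro a
    rw [qPochInf, qPochInf, qPochInf,
      ← (multipliable_qPochInf a hp).tprod_mul (multipliable_qPochInf (-a) hp)]
    exact tprod_congr fun i => by ring
  rw [theta, theta, theta, ← div_pow, key, key, div_neg]
  ring

/-- `θ(x; p) = θ(x; p²) θ(xp; p²)`. -/
theorem theta_eq_mul_theta_nome_sq {x p : ℂ} (hp : ‖p‖ < 1) :
    theta x p = theta x (p ^ 2) * theta (x * p) (p ^ 2) := by
  have hp2 : ‖p ^ 2‖ < 1 := by
    rw [norm_pow]; exact pow_lt_one₀ (norm_nonneg p) hp two_ne_zero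
  have key : ∀ a : ℂ, qPochInf a p = qPochInf a (p ^ 2) * qPochInf (a * p) (p ^ 2) := by
    intro a
    have h := tprod_even_mul_odd (f := fun i : ℕ => 1 - a * p ^ i)
      (by simpa [pow_mul] using multipliable_qPochInf a hp2)
      (by simpa [pow_succ', pow_mul, mul_assoc] using multipliable_qPochInf (a * p) hp2)
    rw [qPochInf, ← h]
    simp only [qPochInf, pow_succ', pow_mul, mul_assoc]
  have h2 : p ^ 2 / (x * p) = p / x := by
    rcases eq_or_ne p 0 with rfl | h
    · simp
    · field_simp
  rw [theta, theta, theta, key x, key (p / x), h2, div_mul_eq_mul_div, ← sq]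
  ring

theorem tendsto_theta {ι : Type*} {l : Filter ι} {f g : ι → ℂ} {x p : ℂ} (hp : ‖p‖ < 1)
    (hx : x ≠ 0) (hf : Tendsto f l (𝓝 x)) (hg : Tendsto g l (𝓝 p)) :
    Tendsto (fun i => theta (f i) (g i)) l (𝓝 (theta x p)) :=
  (tendsto_qPochInf hp hf hg).mul (tendsto_qPochInf hp (hg.div hf hx) hg)

theorem differentiableAt_theta {x p : ℂ} (hp : ‖p‖ < 1) (hx : x ≠ 0) :
    DifferentiableAt ℂ (fun x => theta x p) x := by
  have h1 := differentiable_qPochInf hp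
  exact (h1 x).mul ((h1 (p / x)).comp x
    ((differentiableAt_const p).div differentiableAt_id hx))

/-! ### The Weierstrass addition formula -/


theorem countable_setOf_pow_mul_mem {C : Set ℂ} (hC : C.Countable) {c : ℂ} (hc : c ≠ 0) {m : ℕ}
    (hm : m ≠ 0) : {t : ℂ | t ^ m * c ∈ C}.Countable := by
  have h : {t : ℂ | t ^ m * c ∈ C} ⊆ ⋃ d ∈ C, {t : ℂ | t ^ m = d / c} := by
    intro t ht
    simp only [Set.mem_iUnion]
    exact ⟨_, ht, by simp [hc]⟩
  refine (hC.biUnion fun d _ => ?_).mono h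
  refine Set.Finite.countable ?_
  refine (Polynomial.nthRoots m (d / c)).toFinset.finite_toSet.subset fun t ht => ?_
  simpa [Polynomial.mem_nthRoots (Nat.pos_of_ne_zero hm)] using ht

/-- A function on `ℂ∖{0}` that is holomorphic and invariant under `x ↦ xp` is constant. -/
theorem eq_of_differentiableAt_of_mul_nome {p : ℂ} (hp : ‖p‖ < 1) (hp0 : p ≠ 0) {H : ℂ → ℂ}
    (hd : ∀ x ≠ 0, DifferentiableAt ℂ H x) (hH : ∀ x ≠ 0, H (x * p) = H x) {x y : ℂ}
    (hx : x ≠ 0) (hy : y ≠ 0) : H x = H y := by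
  have hz : ∀ k : ℤ, ∀ x ≠ 0, H (x * p ^ k) = H x := by
    intro k
    induction k with
    | zero => simp
    | succ i ih =>
      intro x hx
      rw [zpow_add₀ hp0, zpow_one, ← mul_assoc,
        hH _ (mul_ne_zero hx (zpow_ne_zero _ hp0)), ih x hx]
    | pred i ih =>
      intro x hx
      rw [← ih x hx, ← hH (x * p ^ (-(i : ℤ) - 1)) (mul_ne_zero hx (zpow_ne_zero _ hp0)),
        mul_assoc, zpow_sub₀ hp0, zpow_one, div_mul_cancel₀ _ hp0]
  have hpos : 0 < ‖p‖ := norm_pos_iff.2 hp0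
  -- the closed annulus `‖p‖ ≤ ‖x‖ ≤ 1` contains a fundamental domain
  have hcomp : IsCompact (Metric.closedBall (0 : ℂ) 1 \ Metric.ball 0 ‖p‖) :=
    (isCompact_closedBall _ _).diff Metric.isOpen_ball
  have hcont : ContinuousOn H (Metric.closedBall (0 : ℂ) 1 \ Metric.ball 0 ‖p‖) := by
    intro z hz
    refine (hd z ?_).continuousAt.continuousWithinAt
    rintro rfl
    exact hz.2 (by simpa using hp0)
  obtain ⟨B, hB⟩ := (hcomp.image_of_continuousOn hcont).isBounded.exists_norm_le
  have hbound : ∀ z ≠ 0, ‖H z‖ ≤ B := by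
    intro z hz0
    obtain ⟨n, hn1, hn2⟩ := exists_mem_Ico_zpow (norm_pos_iff.2 hz0)
      (one_lt_inv_iff₀.2 ⟨hpos, hp⟩)
    rw [← hz (n + 1) z hz0]
    refine hB _ ⟨_, ⟨?_, ?_⟩, rfl⟩
    · rw [mem_closedBall_zero_iff, norm_mul, norm_zpow]
      rw [inv_zpow] at hn2
      exact (mul_le_mul_of_nonneg_right hn2.le (by positivity)).trans
        (inv_mul_cancel₀ (by positivity)).le
    · rw [mem_ball_zero_iff, not_lt, norm_mul, norm_zpow, zpow_add₀ hpos.ne', zpow_one]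
      rw [inv_zpow] at hn1
      calc ‖p‖ = (‖p‖ ^ n)⁻¹ * (‖p‖ ^ n * ‖p‖) := by field_simp
        _ ≤ _ := mul_le_mul_of_nonneg_right hn1 (by positivity)
  have hF : Differentiable ℂ fun z => H (Complex.exp z) := fun z =>
    (hd _ (Complex.exp_ne_zero z)).comp z Complex.differentiable_exp.differentiableAt
  have := hF.apply_eq_apply_of_bounded
    (isBounded_iff_forall_norm_le.2 ⟨B, by rintro _ ⟨z, rfl⟩; exact hbound _ (Complex.exp_ne_zero z)⟩)
    (Complex.log x) (Complex.log y)
  simpa [Complex.exp_log hx, Complex.exp_log hy] using this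

theorem deriv_mul_nome {p : ℂ} (hp0 : p ≠ 0) {f m : ℂ → ℂ}
    (hm : ∀ x ≠ 0, DifferentiableAt ℂ m x) (hf : ∀ x ≠ 0, DifferentiableAt ℂ f x)
    (h : ∀ x ≠ 0, f (x * p) = m x * f x) {x : ℂ} (hx : x ≠ 0) (h0 : f x = 0) :
    deriv f (x * p) * p = m x * deriv f x := by
  have h1 : HasDerivAt (fun x => f (x * p)) (deriv f (x * p) * p) x := by
    have := HasDerivAt.comp x (hf (x * p) (mul_ne_zero hx hp0)).hasDerivAt
      ((hasDerivAt_id x).mul_const p)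
    rw [one_mul] at this
    exact this
  have h2 := (hm x hx).hasDerivAt.mul (hf x hx).hasDerivAt
  rw [h0, mul_zero, zero_add] at h2
  refine h1.unique (h2.congr_of_eventuallyEq ?_)
  filter_upwards [isOpen_ne.mem_nhds hx] with y hy using h y hy

theorem deriv_theta_ne_zero {x p : ℂ} (hp : ‖p‖ < 1) (hp0 : p ≠ 0) (hx : theta x p = 0) :
    deriv (fun x => theta x p) x ≠ 0 := by
  obtain ⟨k, rfl⟩ : ∃ k : ℤ, x = p ^ k := by
    by_contra! h
    exact theta_ne_zero hp hp0 h hx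
  have key : ∀ x ≠ 0, theta x p = 0 → deriv (fun x => theta x p) (x * p) * p
      = -x⁻¹ * deriv (fun x => theta x p) x := fun x hx h0 =>
    deriv_mul_nome (m := fun x => -x⁻¹) hp0 (fun x hx => (differentiableAt_inv hx).neg)
      (fun x hx => differentiableAt_theta hp hx) (fun x hx => theta_mul_nome hp hp0 hx) hx h0
  have main : ∀ k : ℤ, theta (p ^ k) p = 0 ∧ deriv (fun x => theta x p) (p ^ k) ≠ 0 := by
    intro k
    induction k with
    | zero =>
      refine ⟨by simp [theta_one hp], ?_⟩
      have hd : DifferentiableAt ℂ (fun x => qPochInf (x * p) p * qPochInf (p / x) p) 1 := by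
        have h1 := differentiable_qPochInf hp
        exact ((h1 (1 * p)).comp 1 (differentiableAt_id.mul_const p)).mul
          ((h1 (p / 1)).comp 1 ((differentiableAt_const p).div differentiableAt_id one_ne_zero))
      have h2 := ((hasDerivAt_id (1 : ℂ)).const_sub 1).mul hd.hasDerivAt
      have h3 : HasDerivAt (fun x => theta x p) _ 1 :=
        h2.congr_of_eventuallyEq (Eventually.of_forall fun x => theta_eq_one_sub_mul x hp)
      rw [zpow_zero, h3.deriv]
      have h4 : qPochInf p p ≠ 0 := qPochInf_ne_zero hp fun i hi => by
        have := congrArg norm hi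
        rw [← pow_succ', norm_pow, norm_one] at this
        exact (pow_lt_one₀ (norm_nonneg p) hp (Nat.succ_ne_zero i)).ne this
      simpa using h4
    | succ i ih =>
      have hi : p ^ (i : ℤ) ≠ 0 := zpow_ne_zero _ hp0
      rw [zpow_add₀ hp0, zpow_one]
      refine ⟨by rw [theta_mul_nome hp hp0 hi, ih.1, mul_zero], fun h => ?_⟩
      have := key _ hi ih.1
      rw [h, zero_mul, eq_comm] at this
      simp only [mul_eq_zero, neg_eq_zero, inv_eq_zero, hi, ih.2, or_self] at this
    | pred i ih =>
      have hi : p ^ (-(i : ℤ) - 1) ≠ 0 := zpow_ne_zero _ hp0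
      have e : p ^ (-(i : ℤ)) = p ^ (-(i : ℤ) - 1) * p := by
        rw [zpow_sub₀ hp0, zpow_one, div_mul_cancel₀ _ hp0]
      rw [e] at ih
      have h0 : theta (p ^ (-(i : ℤ) - 1)) p = 0 := by
        have := ih.1
        rw [theta_mul_nome hp hp0 hi] at this
        simpa [hi] using this
      refine ⟨h0, fun h => ?_⟩
      have := key _ hi h0
      rw [h, mul_zero] at this
      exact (mul_ne_zero ih.2 hp0) this
  exact (main k).2

/-- Two functions on `ℂ∖{0}` with the same multiplier under `x ↦ xp` are proportional if the second
has only simple zeros and the first vanishes there: their quotient is holomorphic and elliptic. -/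
theorem mul_eq_mul_of_same_multiplier {p : ℂ} (hp : ‖p‖ < 1) (hp0 : p ≠ 0) {D g m : ℂ → ℂ}
    (hm : ∀ x ≠ 0, DifferentiableAt ℂ m x) (hm0 : ∀ x ≠ 0, m x ≠ 0)
    (hD : ∀ x ≠ 0, DifferentiableAt ℂ D x) (hg : ∀ x ≠ 0, DifferentiableAt ℂ g x)
    (hDm : ∀ x ≠ 0, D (x * p) = m x * D x) (hgm : ∀ x ≠ 0, g (x * p) = m x * g x)
    (h0 : ∀ x ≠ 0, g x = 0 → D x = 0 ∧ deriv g x ≠ 0) {x y : ℂ} (hx : x ≠ 0) (hy : y ≠ 0)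
    (hgx : g x ≠ 0) (hgy : g y ≠ 0) : D x * g y = D y * g x := by
  classical
  let H : ℂ → ℂ := fun x => if g x = 0 then deriv D x / deriv g x else D x / g x
  have hH : H x = H y := by
    refine eq_of_differentiableAt_of_mul_nome hp hp0 ?_ ?_ hx hy
    · intro z hz
      by_cases hgz : g z = 0
      · -- near a zero `z` both functions are divisible by `x - z`
        obtain ⟨hDz, hg'⟩ := h0 z hz hgz
        have hs : {w : ℂ | w ≠ 0} ∈ 𝓝 z := isOpen_ne.mem_nhds hz
        have d1 : DifferentiableAt ℂ (dslope D z) z :=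
          ((Complex.differentiableOn_dslope hs).2
            fun w hw => (hD w hw).differentiableWithinAt).differentiableAt hs
        have d2 : DifferentiableAt ℂ (dslope g z) z :=
          ((Complex.differentiableOn_dslope hs).2
            fun w hw => (hg w hw).differentiableWithinAt).differentiableAt hs
        have hg2 : dslope g z z ≠ 0 := by rwa [dslope_same]
        refine (d1.div d2 hg2).congr_of_eventuallyEq ?_
        filter_upwards [d2.continuousAt.eventually_ne hg2] with w hw
        rcases eq_or_ne w z with rfl | hwz
        · simp [H, hgz]
        · have e1 : (w - z) * dslope D z w = D w := by
            simpa [hDz] using sub_smul_dslope D z w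
          have e2 : (w - z) * dslope g z w = g w := by
            simpa [hgz] using sub_smul_dslope g z w
          have hwz' := sub_ne_zero.2 hwz
          have hgw : g w ≠ 0 := by rw [← e2]; exact mul_ne_zero hwz' hw
          simp only [H, if_neg hgw, Pi.div_apply]
          rw [← e1, ← e2, mul_div_mul_left _ _ hwz']
      · refine ((hD z hz).div (hg z hz) hgz).congr_of_eventuallyEq ?_
        filter_upwards [(hg z hz).continuousAt.eventually_ne hgz] with w hw
        simp [H, hw]
    · intro z hz
      by_cases hgz : g z = 0
      · obtain ⟨hDz, hg'⟩ := h0 z hz hgz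
        have hgz2 : g (z * p) = 0 := by rw [hgm z hz, hgz, mul_zero]
        simp only [H, hgz, hgz2, if_true]
        rw [← mul_div_mul_right _ _ hp0, deriv_mul_nome hp0 hm hD hDm hz hDz,
          deriv_mul_nome hp0 hm hg hgm hz hgz, mul_div_mul_left _ _ (hm0 z hz)]
      · have hgz2 : g (z * p) ≠ 0 := by rw [hgm z hz]; exact mul_ne_zero (hm0 z hz) hgz
        simp only [H, hgz, hgz2, if_false]
        rw [hDm z hz, hgm z hz, mul_div_mul_left _ _ (hm0 z hz)]
  simp only [H, hgx, hgy, if_false] at hH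
  rwa [div_eq_div_iff hgx hgy] at hH

theorem theta_mul_theta_mul_nome {x y p : ℂ} (hp : ‖p‖ < 1) (hp0 : p ≠ 0) (hx : x ≠ 0)
    (hy : y ≠ 0) : theta (x * p * y) p * theta (x * p / y) p
      = (x ^ 2)⁻¹ * (theta (x * y) p * theta (x / y) p) := by
  rw [show x * p * y = x * y * p by ring, show x * p / y = x / y * p by ring,
    theta_mul_nome hp hp0 (mul_ne_zero hx hy), theta_mul_nome hp hp0 (div_ne_zero hx hy)]
  field_simp

theorem theta_mul_theta_inv {x y p : ℂ} (hp : ‖p‖ < 1) (hx : x ≠ 0) (hy : y ≠ 0) :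
    theta (x⁻¹ * y) p * theta (x⁻¹ / y) p = (x ^ 2)⁻¹ * (theta (x * y) p * theta (x / y) p) := by
  rw [show x⁻¹ * y = (x / y)⁻¹ by field_simp, show x⁻¹ / y = (x * y)⁻¹ by field_simp,
    theta_inv hp (mul_ne_zero hx hy), theta_inv hp (div_ne_zero hx hy)]
  field_simp

theorem theta_div_swap {x y p : ℂ} (hp : ‖p‖ < 1) (hx : x ≠ 0) (hy : y ≠ 0) :
    theta (y / x) p = -(y / x) * theta (x / y) p := by
  rw [← inv_div x y, theta_inv hp (div_ne_zero hx hy)]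

theorem theta_weierstrass_of_generic {x y u v p : ℂ} (hp : ‖p‖ < 1) (hp0 : p ≠ 0) (hx : x ≠ 0)
    (hy : y ≠ 0) (hu : u ≠ 0) (hv : v ≠ 0) (h1 : ∀ k : ℤ, u ^ 2 ≠ p ^ k)
    (h2 : ∀ k : ℤ, v * u ≠ p ^ k) (h3 : ∀ k : ℤ, v / u ≠ p ^ k) :
    theta (x * y) p * theta (x / y) p * (theta (u * v) p * theta (u / v) p)
      - theta (x * v) p * theta (x / v) p * (theta (u * y) p * theta (u / y) p)
      = u / y * (theta (y * v) p * theta (y / v) p * (theta (x * u) p * theta (x / u) p)) := by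
  set D : ℂ → ℂ := fun x =>
    theta (x * y) p * theta (x / y) p * (theta (u * v) p * theta (u / v) p)
      - theta (x * v) p * theta (x / v) p * (theta (u * y) p * theta (u / y) p)
      - u / y * (theta (y * v) p * theta (y / v) p * (theta (x * u) p * theta (x / u) p)) with hD
  set g : ℂ → ℂ := fun x => theta (x * u) p * theta (x / u) p with hg
  have dd : ∀ w ≠ 0, ∀ x ≠ 0,
      DifferentiableAt ℂ (fun x => theta (x * w) p) x := fun w hw x hx =>
    (differentiableAt_theta hp (mul_ne_zero hx hw)).comp x (differentiableAt_id.mul_const w)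
  have dd2 : ∀ w ≠ 0, ∀ x ≠ 0,
      DifferentiableAt ℂ (fun x => theta (x / w) p) x := fun w hw x hx =>
    DifferentiableAt.comp x (g := fun x => theta x p) (f := fun x => x / w)
      (differentiableAt_theta hp (div_ne_zero hx hw)) (differentiableAt_id.div_const w)
  have ddg : ∀ w ≠ 0, ∀ x ≠ 0,
      DifferentiableAt ℂ (fun x => theta (x * w) p * theta (x / w) p) x := fun w hw x hx =>
    (dd w hw x hx).mul (dd2 w hw x hx)
  have hDm : ∀ x ≠ 0, D (x * p) = (x ^ 2)⁻¹ * D x := by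
    intro x hx
    simp only [hD, theta_mul_theta_mul_nome hp hp0 hx hy, theta_mul_theta_mul_nome hp hp0 hx hu,
      theta_mul_theta_mul_nome hp hp0 hx hv]
    ring
  have hDi : ∀ x ≠ 0, D x⁻¹ = (x ^ 2)⁻¹ * D x := by
    intro x hx
    simp only [hD, theta_mul_theta_inv hp hx hy, theta_mul_theta_inv hp hx hu,
      theta_mul_theta_inv hp hx hv]
    ring
  have hDu : D u = 0 := by
    simp only [hD, div_self hu, theta_one hp]
    ring
  have hDv : D v = 0 := by
    simp only [hD, div_self hv, theta_one hp, theta_div_swap hp hy hv, theta_div_swap hp hu hv,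
      mul_comm v y, mul_comm v u]
    field_simp
    ring
  have hDz : ∀ k : ℤ, ∀ x ≠ 0, D x = 0 → D (x * p ^ k) = 0 := by
    intro k
    induction k with
    | zero => simp
    | succ i ih =>
      intro x hx h
      rw [zpow_add₀ hp0, zpow_one, ← mul_assoc, hDm _ (mul_ne_zero hx (zpow_ne_zero _ hp0)),
        ih x hx h, mul_zero]
    | pred i ih =>
      intro x hx h
      have hne := mul_ne_zero hx (zpow_ne_zero (-(i : ℤ) - 1) hp0)
      have := ih x hx h
      rw [show x * p ^ (-(i : ℤ)) = x * p ^ (-(i : ℤ) - 1) * p by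
        rw [zpow_sub₀ hp0, zpow_one]; field_simp, hDm _ hne] at this
      exact (mul_eq_zero.1 this).resolve_left (inv_ne_zero (pow_ne_zero 2 hne))
  have hz : ∀ w ≠ 0, theta w p = 0 → ∃ k : ℤ, w = p ^ k := by
    intro w _ hw
    by_contra! h
    exact theta_ne_zero hp hp0 h hw
  have h0 : ∀ x ≠ 0, g x = 0 → D x = 0 ∧ deriv g x ≠ 0 := by
    intro x hx hgx
    have hxu := mul_ne_zero hx hu
    have hxu' := div_ne_zero hx hu
    have c1 : HasDerivAt (fun x => theta (x * u) p)
        (deriv (fun x => theta x p) (x * u) * u) x := by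
      have := HasDerivAt.comp x (differentiableAt_theta hp hxu).hasDerivAt
        ((hasDerivAt_id x).mul_const u)
      rw [one_mul] at this
      exact this
    have c2 : HasDerivAt (fun x => theta (x / u) p)
        (deriv (fun x => theta x p) (x / u) * (1 / u)) x :=
      HasDerivAt.comp (h₂ := fun x => theta x p) (h := fun x => x / u) x
        (differentiableAt_theta hp hxu').hasDerivAt ((hasDerivAt_id x).div_const u)
    have c3 : deriv g x = _ := (c1.mul c2).deriv
    rw [c3]
    rcases mul_eq_zero.1 hgx with h | h
    · obtain ⟨k, hk⟩ := hz _ hxu h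
      refine ⟨?_, ?_⟩
      · rw [show x = u⁻¹ * p ^ k by rw [← hk]; field_simp]
        exact hDz k _ (inv_ne_zero hu) (by rw [hDi u hu, hDu, mul_zero])
      · rw [h, zero_mul, add_zero]
        refine mul_ne_zero (mul_ne_zero (deriv_theta_ne_zero hp hp0 h) hu) fun h' => ?_
        obtain ⟨l, hl⟩ := hz _ hxu' h'
        refine h1 (k - l) ?_
        rw [zpow_sub₀ hp0, ← hk, ← hl]
        field_simp
    · obtain ⟨k, hk⟩ := hz _ hxu' h
      refine ⟨?_, ?_⟩
      · rw [show x = u * p ^ k by rw [← hk]; field_simp]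
        exact hDz k _ hu hDu
      · rw [h, mul_zero, zero_add]
        refine mul_ne_zero (fun h' => ?_)
          (mul_ne_zero (deriv_theta_ne_zero hp hp0 h) (one_div_ne_zero hu))
        obtain ⟨l, hl⟩ := hz _ hxu h'
        refine h1 (l - k) ?_
        rw [zpow_sub₀ hp0, ← hk, ← hl]
        field_simp
  have hgv : g v ≠ 0 := mul_ne_zero (theta_ne_zero hp hp0 h2) (theta_ne_zero hp hp0 h3)
  suffices D x = 0 by
    simp only [hD] at this
    linear_combination this
  by_cases hgx : g x = 0
  · exact (h0 x hx hgx).1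
  have := mul_eq_mul_of_same_multiplier hp hp0 (D := D) (g := g) (m := fun x => (x ^ 2)⁻¹)
    (fun x hx => (differentiableAt_id.pow 2).inv (pow_ne_zero 2 hx))
    (fun x hx => inv_ne_zero (pow_ne_zero 2 hx))
    (fun x hx => (((ddg y hy x hx).mul_const _).sub ((ddg v hv x hx).mul_const _)).sub
      (((ddg u hu x hx).const_mul _).const_mul _))
    (fun x hx => ddg u hu x hx) hDm
    (fun x hx => theta_mul_theta_mul_nome hp hp0 hx hu) h0 hx hv hgx hgv
  rw [hDv, zero_mul] at this
  exact (mul_eq_zero.1 this).resolve_right hgv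

/-- The Weierstrass addition formula for `θ(·; p)`. -/
theorem theta_weierstrass {x y u v p : ℂ} (hp : ‖p‖ < 1) (hp0 : p ≠ 0) (hx : x ≠ 0)
    (hy : y ≠ 0) (hu : u ≠ 0) (hv : v ≠ 0) :
    theta (x * y) p * theta (x / y) p * (theta (u * v) p * theta (u / v) p)
      - theta (x * v) p * theta (x / v) p * (theta (u * y) p * theta (u / y) p)
      = u / y * (theta (y * v) p * theta (y / v) p * (theta (x * u) p * theta (x / u) p)) := by
  -- deform `(u, v)` to `(t u, t ^ 3 v)`, which is generic for all `t` outside a countable set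
  have hC : (Set.range fun k : ℤ => p ^ k).Countable := Set.countable_range _
  obtain ⟨S, hSc, hS⟩ : ∃ S : Set ℂ, S.Countable ∧ ∀ t ∉ S, t ≠ 0 ∧ (∀ k : ℤ, t ^ 2 * u ^ 2 ≠ p ^ k)
      ∧ (∀ k : ℤ, t ^ 4 * (v * u) ≠ p ^ k) ∧ ∀ k : ℤ, t ^ 2 * (v / u) ≠ p ^ k := by
    refine ⟨_, (Set.countable_singleton (0 : ℂ)).union
      ((countable_setOf_pow_mul_mem hC (pow_ne_zero 2 hu) two_ne_zero).union
      ((countable_setOf_pow_mul_mem hC (mul_ne_zero hv hu) four_ne_zero).union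
      (countable_setOf_pow_mul_mem hC (div_ne_zero hv hu) two_ne_zero))), fun t ht => ?_⟩
    simpa [eq_comm] using ht
  have hne := mem_closure_iff_nhdsWithin_neBot.1 (hSc.dense_compl ℂ 1)
  have ht : Tendsto (fun t : ℂ => t) (𝓝[Sᶜ] 1) (𝓝 1) := tendsto_id.mono_left inf_le_left
  have htu : Tendsto (fun t : ℂ => t * u) (𝓝[Sᶜ] 1) (𝓝 u) := by
    simpa using ht.mul_const u
  have htv : Tendsto (fun t : ℂ => t ^ 3 * v) (𝓝[Sᶜ] 1) (𝓝 v) := by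
    simpa using (ht.pow 3).mul_const v
  have T : ∀ {f : ℂ → ℂ} {z : ℂ}, z ≠ 0 → Tendsto f (𝓝[Sᶜ] 1) (𝓝 z) →
      Tendsto (fun t => theta (f t) p) (𝓝[Sᶜ] 1) (𝓝 (theta z p)) := fun hz hf =>
    tendsto_theta hp hz hf tendsto_const_nhds
  refine tendsto_nhds_unique (l := 𝓝[Sᶜ] 1) (f := fun t : ℂ =>
    theta (x * y) p * theta (x / y) p
        * (theta (t * u * (t ^ 3 * v)) p * theta (t * u / (t ^ 3 * v)) p)
      - theta (x * (t ^ 3 * v)) p * theta (x / (t ^ 3 * v)) p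
        * (theta (t * u * y) p * theta (t * u / y) p)) ?_ ?_
  · exact (((T (mul_ne_zero hu hv) (htu.mul htv)).mul
      (T (div_ne_zero hu hv) (htu.div htv hv))).const_mul _).sub
      (((T (mul_ne_zero hx hv) (htv.const_mul x)).mul
      (T (div_ne_zero hx hv) (tendsto_const_nhds.div htv hv))).mul
      ((T (mul_ne_zero hu hy) (htu.mul_const y)).mul
      (T (div_ne_zero hu hy) (htu.div_const y))))
  · refine Tendsto.congr' (f₁ := fun t : ℂ => t * u / y *
      (theta (y * (t ^ 3 * v)) p * theta (y / (t ^ 3 * v)) p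
        * (theta (x * (t * u)) p * theta (x / (t * u)) p))) ?_ ?_
    · filter_upwards [self_mem_nhdsWithin] with t ht
      obtain ⟨h0, h1, h2, h3⟩ := hS t ht
      refine (theta_weierstrass_of_generic hp hp0 hx hy (mul_ne_zero h0 hu)
        (mul_ne_zero (pow_ne_zero 3 h0) hv) (fun k hk => h1 k ?_) (fun k hk => h2 k ?_)
        (fun k hk => h3 k ?_)).symm
      · rw [← hk]; ring
      · rw [← hk]; ring
      · rw [← hk]; field_simp
    · exact (htu.div_const y).mul (((T (mul_ne_zero hy hv) (htv.const_mul y)).mul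
        (T (div_ne_zero hy hv) (tendsto_const_nhds.div htv hv))).mul
        ((T (mul_ne_zero hx hu) (htu.const_mul x)).mul
        (T (div_ne_zero hx hu) (tendsto_const_nhds.div htu hu))))

/-! ### Theta shifted factorials -/

theorem thetaPoch_zero (x q p : ℂ) : thetaPoch x q p 0 = 1 := by
  simp [thetaPoch]

theorem thetaPoch_succ (x q p : ℂ) (k : ℕ) :
    thetaPoch x q p (k + 1) = thetaPoch x q p k * theta (x * q ^ k) p :=
  Finset.prod_range_succ _ _

theorem thetaPoch_succ' (x q p : ℂ) (k : ℕ) :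
    thetaPoch x q p (k + 1) = theta x p * thetaPoch (x * q) q p k := by
  rw [thetaPoch, Finset.prod_range_succ', thetaPoch, mul_comm]
  simp [pow_succ', mul_assoc]

theorem thetaPoch_add (x q p : ℂ) (m k : ℕ) :
    thetaPoch x q p (m + k) = thetaPoch x q p m * thetaPoch (x * q ^ m) q p k := by
  rw [thetaPoch, Finset.prod_range_add]
  simp [thetaPoch, pow_add, mul_assoc]

/-- No value `θ(x qⁱ; p)` with `i ∈ ℤ` vanishes. -/
def ThetaGeneric (x q p : ℂ) : Prop := ∀ i : ℤ, theta (x * q ^ i) p ≠ 0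

namespace ThetaGeneric

variable {x q p : ℂ}

theorem theta_ne_zero (h : ThetaGeneric x q p) : theta x p ≠ 0 := by
  simpa using h 0

theorem mul_zpow (h : ThetaGeneric x q p) (hq : q ≠ 0) (i : ℤ) :
    ThetaGeneric (x * q ^ i) q p := fun j => by
  rw [mul_assoc, ← zpow_add₀ hq]
  exact h _

theorem mul_pow (h : ThetaGeneric x q p) (hq : q ≠ 0) (i : ℕ) :
    ThetaGeneric (x * q ^ i) q p := by
  simpa using h.mul_zpow hq i

theorem mul (h : ThetaGeneric x q p) (hq : q ≠ 0) : ThetaGeneric (x * q) q p := by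
  simpa using h.mul_zpow hq 1

theorem inv (h : ThetaGeneric x q p) (hp : ‖p‖ < 1) (hx : x ≠ 0) (hq : q ≠ 0) :
    ThetaGeneric x⁻¹ q p := fun i => by
  have e : x⁻¹ * q ^ i = (x * q ^ (-i))⁻¹ := by rw [zpow_neg]; field_simp
  have hne : x * q ^ (-i) ≠ 0 := mul_ne_zero hx (zpow_ne_zero _ hq)
  rw [e, theta_inv hp hne]
  exact mul_ne_zero (neg_ne_zero.2 (inv_ne_zero hne)) (h _)

theorem thetaPoch_ne_zero (h : ThetaGeneric x q p) (k : ℕ) : thetaPoch x q p k ≠ 0 :=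
  Finset.prod_ne_zero_iff.2 fun j _ => by simpa using h j

end ThetaGeneric

/-! ### The Frenkel–Turaev summation -/

/-- The part of the summand in the Frenkel–Turaev sum that does not depend on its length. -/
noncomputable def ftBase (a b c d q p : ℂ) (k : ℕ) : ℂ :=
  theta (a * q ^ (2 * k)) p / theta a p
    * (thetaPoch a q p k * thetaPoch b q p k * thetaPoch c q p k * thetaPoch d q p k
      / (thetaPoch q q p k * thetaPoch (a * q / b) q p k * thetaPoch (a * q / c) q p k
        * thetaPoch (a * q / d) q p k)) * q ^ k

/-- The part of the summand in the Frenkel–Turaev sum that depends on its length `N`, where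
`z = q ^ (N + 1)` and `g = bcd / a`. -/
noncomputable def ftTail (a g z q p : ℂ) (k : ℕ) : ℂ :=
  thetaPoch (a * z / g) q p k * thetaPoch (q / z) q p k
    / (thetaPoch (g * q / z) q p k * thetaPoch (a * z) q p k)

/-- The closed form of the Frenkel–Turaev sum, where `g = bcd / a`. -/
noncomputable def ftValue (a b c d g q p : ℂ) (N : ℕ) : ℂ :=
  thetaPoch (a * q) q p N * thetaPoch (a * q / (b * c)) q p N * thetaPoch (a * q / (b * d)) q p N
      * thetaPoch (a * q / (c * d)) q p N
    / (thetaPoch (a * q / b) q p N * thetaPoch (a * q / c) q p N * thetaPoch (a * q / d) q p N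
      * thetaPoch (q / g) q p N)

theorem theta_addition_tail {a g z s p : ℂ} (hp : ‖p‖ < 1) (hp0 : p ≠ 0) (ha : a ≠ 0)
    (hg : g ≠ 0) (hz : z ≠ 0) (hs : s ≠ 0) :
    theta (a * z * s / g) p * theta (g * s / z) p * (theta (a * z) p * theta z⁻¹ p)
      - theta (a * z / g) p * theta (g / z) p * (theta (a * z * s) p * theta (s / z) p)
      = -z⁻¹ * (theta (a * z ^ 2 / g) p * theta g p * (theta s p * theta (a * s) p)) := by
  obtain ⟨r, rfl⟩ : ∃ r, r ^ 2 = a := IsAlgClosed.exists_pow_nat_eq a two_pos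
  have hr : r ≠ 0 := by rintro rfl; simp at ha
  have h := theta_weierstrass (x := s * r) (y := z * r / g) (u := r) (v := z * r) hp hp0
    (by positivity) (by positivity) hr (by positivity)
  rw [show s * r * (z * r / g) = r ^ 2 * z * s / g by ring,
    show s * r / (z * r / g) = g * s / z by field_simp,
    show r * (z * r) = r ^ 2 * z by ring, show r / (z * r) = z⁻¹ by field_simp,
    show s * r * (z * r) = r ^ 2 * z * s by ring, show s * r / (z * r) = s / z by field_simp,
    show r * (z * r / g) = r ^ 2 * z / g by ring, show r / (z * r / g) = g / z by field_simp,
    show z * r / g * (z * r) = r ^ 2 * z ^ 2 / g by ring,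
    show z * r / g / (z * r) = g⁻¹ by field_simp, show s * r * r = r ^ 2 * s by ring,
    show s * r / r = s by field_simp, theta_inv hp hg] at h
  have hgg : g * g⁻¹ = 1 := mul_inv_cancel₀ hg
  linear_combination h - z⁻¹ * theta (r ^ 2 * z ^ 2 / g) p * theta g p * theta s p
    * theta (r ^ 2 * s) p * hgg

theorem theta_addition_value {a b c d g z p : ℂ} (hp : ‖p‖ < 1) (hp0 : p ≠ 0) (ha : a ≠ 0)
    (hb : b ≠ 0) (hc : c ≠ 0) (hd : d ≠ 0) (hz : z ≠ 0) (hg : g * a = b * c * d) :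
    theta (a * z) p * theta (a * z / (b * c)) p
        * (theta (a * z / (b * d)) p * theta (a * z / (c * d)) p)
      - theta (a * z / b) p * theta (a * z / c) p * (theta (a * z / d) p * theta (z / g) p)
      = z / g * (theta (a * z ^ 2 / g) p * theta b p * (theta c p * theta d p)) := by
  obtain rfl : g = b * c * d / a := by field_simp; exact hg
  obtain ⟨β, rfl⟩ : ∃ r, r ^ 2 = b := IsAlgClosed.exists_pow_nat_eq b two_pos
  obtain ⟨γ, rfl⟩ : ∃ r, r ^ 2 = c := IsAlgClosed.exists_pow_nat_eq c two_pos
  have hβ : β ≠ 0 := by rintro rfl; simp at hb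
  have hγ : γ ≠ 0 := by rintro rfl; simp at hc
  have h := theta_weierstrass (x := a * z / (β * γ)) (y := β * γ) (u := a * z / (β * γ * d))
    (v := γ / β) hp hp0 (by positivity) (by positivity) (by positivity) (by positivity)
  rw [show a * z / (β * γ) * (β * γ) = a * z by field_simp,
    show a * z / (β * γ) / (β * γ) = a * z / (β ^ 2 * γ ^ 2) by field_simp,
    show a * z / (β * γ * d) * (γ / β) = a * z / (β ^ 2 * d) by field_simp,
    show a * z / (β * γ * d) / (γ / β) = a * z / (γ ^ 2 * d) by field_simp,
    show a * z / (β * γ) * (γ / β) = a * z / β ^ 2 by field_simp,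
    show a * z / (β * γ) / (γ / β) = a * z / γ ^ 2 by field_simp,
    show a * z / (β * γ * d) * (β * γ) = a * z / d by field_simp,
    show a * z / (β * γ * d) / (β * γ) = z / (β ^ 2 * γ ^ 2 * d / a) by field_simp,
    show β * γ * (γ / β) = γ ^ 2 by field_simp, show β * γ / (γ / β) = β ^ 2 by field_simp,
    show a * z / (β * γ) * (a * z / (β * γ * d)) = a * z ^ 2 / (β ^ 2 * γ ^ 2 * d / a) by
      field_simp,
    show a * z / (β * γ) / (a * z / (β * γ * d)) = d by field_simp] at h
  rw [h]
  ring

theorem ftTail_succ_sub {a g z q p : ℂ} (hp : ‖p‖ < 1) (hp0 : p ≠ 0) (ha : a ≠ 0) (hg : g ≠ 0)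
    (hz : z ≠ 0) (hq : q ≠ 0) (hGa : ThetaGeneric (a * z) q p) (hGg : ThetaGeneric (g / z) q p)
    (k : ℕ) :
    ftTail a g (z * q) q p (k + 1) - ftTail a g z q p (k + 1)
      = -z⁻¹ * theta (a * z ^ 2 / g) p * theta g p
          / (theta (g / z) p * theta (a * z) p * theta (g / z * q) p * theta (a * z * q) p)
        * (theta (q * q ^ k) p * theta (a * (q * q ^ k)) p)
        * ftTail (a * q ^ 2) (g * q) z q p k := by
  have e1 : thetaPoch (g / z * q) q p k * theta (g / z * q * q ^ k) p
      = theta (g / z * q) p * thetaPoch (g / z * q * q) q p k := by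
    rw [← thetaPoch_succ, thetaPoch_succ']
  have e2 : thetaPoch (a * z * q) q p k * theta (a * z * q * q ^ k) p
      = theta (a * z * q) p * thetaPoch (a * z * q * q) q p k := by
    rw [← thetaPoch_succ, thetaPoch_succ']
  have hw := theta_addition_tail (s := q * q ^ k) hp hp0 ha hg hz (by positivity)
  rw [show a * z * (q * q ^ k) / g = a * z / g * q * q ^ k by ring,
    show g * (q * q ^ k) / z = g / z * q * q ^ k by ring,
    show a * z * (q * q ^ k) = a * z * q * q ^ k by ring,
    show q * q ^ k / z = q / z * q ^ k by ring] at hw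
  have n1 := hGa.theta_ne_zero
  have n2 := hGg.theta_ne_zero
  have n3 := (hGa.mul hq).theta_ne_zero
  have n4 := (hGg.mul hq).theta_ne_zero
  have n5 := (hGa.mul hq).thetaPoch_ne_zero k
  have n6 := (hGg.mul hq).thetaPoch_ne_zero k
  have n7 := ((hGa.mul hq).mul hq).thetaPoch_ne_zero k
  have n8 := ((hGg.mul hq).mul hq).thetaPoch_ne_zero k
  have n9 := ((hGa.mul hq).mul_pow hq k).theta_ne_zero
  have n10 := ((hGg.mul hq).mul_pow hq k).theta_ne_zero
  simp only [ftTail]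
  rw [show a * (z * q) / g = a * z / g * q by ring, show q / (z * q) = z⁻¹ by field_simp,
    show g * q / (z * q) = g / z by field_simp, show a * (z * q) = a * z * q by ring,
    show g * q / z = g / z * q by ring, show a * q ^ 2 * z / (g * q) = a * z / g * q by field_simp,
    show g * q * q / z = g / z * q * q by ring, show a * q ^ 2 * z = a * z * q * q by ring]
  rw [thetaPoch_succ (a * z / g * q), thetaPoch_succ' z⁻¹, thetaPoch_succ' (g / z),
    thetaPoch_succ (a * z * q), thetaPoch_succ' (a * z / g), thetaPoch_succ (q / z),
    thetaPoch_succ (g / z * q), thetaPoch_succ' (a * z), show z⁻¹ * q = q / z by ring]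
  generalize thetaPoch (g / z * q * q) q p k = Y3 at *
  generalize thetaPoch (a * z * q * q) q p k = Y4 at *
  generalize thetaPoch (g / z * q) q p k = X3 at *
  generalize thetaPoch (a * z * q) q p k = X4 at *
  generalize thetaPoch (a * z / g * q) q p k = X1 at *
  generalize thetaPoch (q / z) q p k = X2 at *
  generalize theta (g / z * q * q ^ k) p = t1 at *
  generalize theta (a * z * q * q ^ k) p = t2 at *
  generalize theta (a * z / g * q * q ^ k) p = t3 at *
  generalize theta (q / z * q ^ k) p = t4 at *
  generalize theta (g / z * q) p = t5 at *
  generalize theta (a * z * q) p = t6 at *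
  generalize theta (a * z) p = t7 at *
  generalize theta (a * z / g) p = t8 at *
  generalize theta (g / z) p = t9 at *
  generalize theta z⁻¹ p = t10 at *
  generalize theta (a * z ^ 2 / g) p = t11 at *
  generalize theta g p = t12 at *
  obtain rfl : Y3 = X3 * t1 / t5 := by field_simp; rw [e1]; ring
  obtain rfl : Y4 = X4 * t2 / t6 := by field_simp; rw [e2]; ring
  trans (t3 * t1 * (t7 * t10) - t8 * t9 * (t2 * t4)) * (X1 * X2) / (t9 * X3 * X4 * t2 * t1 * t7)
  · field_simp
  · rw [hw]
    field_simp

theorem ftBase_succ {a b c d q p : ℂ} (hb : b ≠ 0) (hc : c ≠ 0) (hd : d ≠ 0) (hq : q ≠ 0)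
    (hGa : ThetaGeneric a q p) (hGb : ThetaGeneric (a / b) q p) (hGc : ThetaGeneric (a / c) q p)
    (hGd : ThetaGeneric (a / d) q p) {k : ℕ} (hqk : thetaPoch q q p (k + 1) ≠ 0) :
    ftBase a b c d q p (k + 1) * (theta (q * q ^ k) p * theta (a * (q * q ^ k)) p)
      = q * theta (a * q) p * theta (a * q ^ 2) p * (theta b p * theta c p * theta d p)
          / (theta (a * q / b) p * theta (a * q / c) p * theta (a * q / d) p)
        * ftBase (a * q ^ 2) (b * q) (c * q) (d * q) q p k := by
  have e1 : theta a p * (theta (a * q) p * thetaPoch (a * q ^ 2) q p k)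
      = thetaPoch a q p (k + 1) * theta (a * (q * q ^ k)) p := by
    rw [← pow_succ' q k, ← thetaPoch_succ, thetaPoch_succ', thetaPoch_succ',
      show a * q * q = a * q ^ 2 by ring]
  have n0 := hGa.theta_ne_zero
  have n1 : theta (a * q ^ 2) p ≠ 0 := (hGa.mul_pow hq 2).theta_ne_zero
  have n2 : theta (a * q / b) p ≠ 0 := by
    simpa [mul_div_right_comm] using (hGb.mul hq).theta_ne_zero
  have n3 : theta (a * q / c) p ≠ 0 := by
    simpa [mul_div_right_comm] using (hGc.mul hq).theta_ne_zero
  have n4 : theta (a * q / d) p ≠ 0 := by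
    simpa [mul_div_right_comm] using (hGd.mul hq).theta_ne_zero
  rw [thetaPoch_succ, mul_ne_zero_iff] at hqk
  simp only [ftBase]
  rw [thetaPoch_succ' b, thetaPoch_succ' c, thetaPoch_succ' d, thetaPoch_succ q,
    thetaPoch_succ' (a * q / b), thetaPoch_succ' (a * q / c), thetaPoch_succ' (a * q / d),
    show a * q ^ 2 * q / (b * q) = a * q / b * q by field_simp,
    show a * q ^ 2 * q / (c * q) = a * q / c * q by field_simp,
    show a * q ^ 2 * q / (d * q) = a * q / d * q by field_simp,
    show a * q ^ 2 * q ^ (2 * k) = a * q ^ (2 * (k + 1)) by ring, pow_succ q k]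
  have e2 : thetaPoch (a * q ^ 2) q p k * (theta a p * theta (a * q) p)
      = thetaPoch a q p (k + 1) * theta (a * (q * q ^ k)) p := by rw [← e1]; ring
  have h5 := hqk.2
  generalize theta (q * q ^ k) p = t0 at *
  generalize theta (a * (q * q ^ k)) p = t1 at *
  generalize thetaPoch (a * q ^ 2) q p k = X at *
  generalize thetaPoch a q p (k + 1) = Y at *
  generalize theta a p = t2 at *
  generalize theta (a * q ^ 2) p = t3 at *
  generalize theta (a * q) p = t4 at *
  have e3 : X * t4 = Y * t1 / t2 := by field_simp; rw [← e2]; ring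
  have hqk1 := hqk.1
  generalize theta (a * q ^ (2 * (k + 1))) p = t5 at *
  generalize thetaPoch q q p k = Q at *
  generalize theta (a * q / b) p = t6 at *
  generalize theta (a * q / c) p = t7 at *
  generalize theta (a * q / d) p = t8 at *
  generalize theta b p = t9
  generalize theta c p = t10
  generalize theta d p = t11
  generalize thetaPoch (b * q) q p k = B
  generalize thetaPoch (c * q) q p k = C
  generalize thetaPoch (d * q) q p k = D
  generalize thetaPoch (a * q / b * q) q p k = B'
  generalize thetaPoch (a * q / c * q) q p k = C'
  generalize thetaPoch (a * q / d * q) q p k = D'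
  clear hGa hGb hGc hGd e1
  trans t5 * (Y * t1 / t2) * (t9 * B * (t10 * C) * (t11 * D))
    / (Q * (t6 * B') * (t7 * C') * (t8 * D')) * (q ^ k * q) * (t0 * t0⁻¹)
  · ring
  trans t5 * (X * t4) * (t9 * B * (t10 * C) * (t11 * D))
    / (Q * (t6 * B') * (t7 * C') * (t8 * D')) * (q ^ k * q) * (t3 * t3⁻¹)
  · rw [e3, mul_inv_cancel₀ h5, mul_inv_cancel₀ n1]
  · ring

theorem ftBase_zero {a b c d q p : ℂ} (ha : theta a p ≠ 0) : ftBase a b c d q p 0 = 1 := by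
  simp [ftBase, thetaPoch_zero, ha]

theorem ftTail_zero (a g z q p : ℂ) : ftTail a g z q p 0 = 1 := by
  simp [ftTail, thetaPoch_zero]

theorem ftTail_eq_zero {a g q p : ℂ} (hp : ‖p‖ < 1) (hq : q ≠ 0) (N : ℕ) :
    ftTail a g (q ^ (N + 1)) q p (N + 1) = 0 := by
  have h : theta (q / q ^ (N + 1) * q ^ N) p = 0 := by
    rw [pow_succ, show q / (q ^ N * q) * q ^ N = 1 by field_simp, theta_one hp]
  rw [ftTail, thetaPoch_succ (q / q ^ (N + 1)), h]
  simp

/-- The right-hand side of the Frenkel–Turaev sum satisfies the recursion that its summand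
satisfies by `ftTail_succ_sub` and `ftBase_succ`. -/
theorem ftValue_succ {a b c d g q p : ℂ} (hp : ‖p‖ < 1) (hp0 : p ≠ 0) (ha : a ≠ 0) (hb : b ≠ 0)
    (hc : c ≠ 0) (hd : d ≠ 0) (hg0 : g ≠ 0) (hq : q ≠ 0) (hg : g * a = b * c * d)
    (hGa : ThetaGeneric a q p) (hGb : ThetaGeneric (a / b) q p) (hGc : ThetaGeneric (a / c) q p)
    (hGd : ThetaGeneric (a / d) q p) (hGg : ThetaGeneric g q p) (N : ℕ) {z : ℂ}
    (hz : z = q ^ (N + 1)) :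
    ftValue a b c d g q p (N + 1) - ftValue a b c d g q p N
      = -z⁻¹ * theta (a * z ^ 2 / g) p * theta g p
          / (theta (g / z) p * theta (a * z) p * theta (g / z * q) p * theta (a * z * q) p)
        * (q * theta (a * q) p * theta (a * q ^ 2) p * (theta b p * theta c p * theta d p)
          / (theta (a * q / b) p * theta (a * q / c) p * theta (a * q / d) p))
        * ftValue (a * q ^ 2) (b * q) (c * q) (d * q) (g * q) q p N := by
  have hz0 : z ≠ 0 := by rw [hz]; positivity
  have hzN : z = q * q ^ N := by rw [hz, pow_succ']
  have hw := theta_addition_value hp hp0 ha hb hc hd hz0 hg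
  have hGgi := hGg.inv hp hg0 hq
  have hGz : ThetaGeneric (g / z) q p := by
    have := hGg.mul_zpow hq (-((N + 1 : ℕ) : ℤ))
    rwa [zpow_neg, zpow_natCast, ← hz] at this
  have shift : ∀ x : ℂ, theta (x * q) p * thetaPoch (x * q * q) q p N
      = thetaPoch (x * q) q p N * theta (x * z) p := fun x => by
    rw [← thetaPoch_succ', thetaPoch_succ, hzN, mul_assoc x q]
  have c1 : theta (a * q) p * theta (a * q ^ 2) p * thetaPoch (a * q ^ 2 * q) q p N
      = thetaPoch (a * q) q p N * theta (a * z) p * theta (a * z * q) p := by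
    have h1 := shift (a * q)
    rw [show a * q * q = a * q ^ 2 by ring, show a * q * z = a * z * q by ring] at h1
    have h2 := shift a
    rw [show a * q * q = a * q ^ 2 by ring] at h2
    rw [mul_assoc, h1, ← mul_assoc, h2]
  have c2 := shift (a / b)
  have c3 := shift (a / c)
  have c4 := shift (a / d)
  have c5 : theta g⁻¹ p * thetaPoch (q / g) q p N
      = thetaPoch g⁻¹ q p N * theta (g / z * q)⁻¹ p := by
    rw [div_eq_inv_mul, ← thetaPoch_succ', thetaPoch_succ]
    congr 2
    rw [hzN]; field_simp
  have c6 : theta (z / g) p = -(z / g) * theta (g / z) p := theta_div_swap hp hg0 hz0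
  rw [theta_inv hp hg0, theta_inv hp (by positivity)] at c5
  rw [c6] at hw
  have n1 : theta (a * z) p ≠ 0 := by rw [hz]; exact (hGa.mul_pow hq _).theta_ne_zero
  have n2 : theta (a * z * q) p ≠ 0 := by rw [hz]; exact ((hGa.mul_pow hq _).mul hq).theta_ne_zero
  have n3 := hGz.theta_ne_zero
  have n4 := (hGz.mul hq).theta_ne_zero
  have n5 := hGg.theta_ne_zero
  have n6 : ∀ x, ThetaGeneric x q p → theta (x * q) p ≠ 0 ∧ theta (x * z) p ≠ 0
      ∧ thetaPoch (x * q) q p N ≠ 0 ∧ thetaPoch (x * q * q) q p N ≠ 0 := fun x hx =>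
    ⟨(hx.mul hq).theta_ne_zero, by rw [hz]; exact (hx.mul_pow hq _).theta_ne_zero,
      (hx.mul hq).thetaPoch_ne_zero N, ((hx.mul hq).mul hq).thetaPoch_ne_zero N⟩
  obtain ⟨b1, b2, b3, b4⟩ := n6 _ hGb
  obtain ⟨c1', c2', c3', c4'⟩ := n6 _ hGc
  obtain ⟨d1, d2, d3, d4⟩ := n6 _ hGd
  have g1 : thetaPoch g⁻¹ q p N ≠ 0 := hGgi.thetaPoch_ne_zero N
  have g2 : thetaPoch (q / g) q p N ≠ 0 := by
    rw [div_eq_inv_mul]; exact (hGgi.mul hq).thetaPoch_ne_zero N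
  simp only [ftValue]
  simp only [thetaPoch_succ _ _ _ N]
  rw [show a * q / b = a / b * q by ring, show a * q / c = a / c * q by ring,
    show a * q / d = a / d * q by ring,
    show a * q ^ 2 * q / (b * q * (c * q)) = a * q / (b * c) by field_simp,
    show a * q ^ 2 * q / (b * q * (d * q)) = a * q / (b * d) by field_simp,
    show a * q ^ 2 * q / (c * q * (d * q)) = a * q / (c * d) by field_simp,
    show a * q ^ 2 * q / (b * q) = a / b * q * q by field_simp,
    show a * q ^ 2 * q / (c * q) = a / c * q * q by field_simp,
    show a * q ^ 2 * q / (d * q) = a / d * q * q by field_simp,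
    show q / (g * q) = g⁻¹ by field_simp,
    show a * q * q ^ N = a * z by rw [hzN]; ring,
    show a / b * q * q ^ N = a / b * z by rw [hzN]; ring,
    show a / c * q * q ^ N = a / c * z by rw [hzN]; ring,
    show a / d * q * q ^ N = a / d * z by rw [hzN]; ring,
    show a * q / (b * c) * q ^ N = a * z / (b * c) by rw [hzN]; ring,
    show a * q / (b * d) * q ^ N = a * z / (b * d) by rw [hzN]; ring,
    show a * q / (c * d) * q ^ N = a * z / (c * d) by rw [hzN]; ring,
    show q / g * q ^ N = z / g by rw [hzN]; ring, c6]
  rw [show a * z / b = a / b * z by ring, show a * z / c = a / c * z by ring,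
    show a * z / d = a / d * z by ring] at hw
  clear shift n6 hGa hGb hGc hGd hGg hGgi hGz c6
  generalize theta (a * z ^ 2 / g) p = w1 at *
  generalize theta (g / z * q) p = w2 at *
  generalize theta (g / z) p = w3 at *
  generalize theta (a * z * q) p = w4 at *
  generalize theta (a * z) p = w5 at *
  generalize thetaPoch (a * q ^ 2 * q) q p N = A2 at *
  generalize theta (a * q ^ 2) p = w6 at *
  generalize thetaPoch (a * q) q p N = A1 at *
  generalize theta (a * q) p = w7 at *
  generalize thetaPoch (a / b * q * q) q p N = B2 at *
  generalize thetaPoch (a / b * q) q p N = B1 at *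
  generalize theta (a / b * q) p = w8 at *
  generalize theta (a / b * z) p = w9 at *
  generalize thetaPoch (a / c * q * q) q p N = C2 at *
  generalize thetaPoch (a / c * q) q p N = C1 at *
  generalize theta (a / c * q) p = w10 at *
  generalize theta (a / c * z) p = w11 at *
  generalize thetaPoch (a / d * q * q) q p N = D2 at *
  generalize thetaPoch (a / d * q) q p N = D1 at *
  generalize theta (a / d * q) p = w12 at *
  generalize theta (a / d * z) p = w13 at *
  generalize thetaPoch g⁻¹ q p N = G2 at *
  generalize thetaPoch (q / g) q p N = G1 at *
  generalize theta g p = w14 at *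
  generalize thetaPoch (a * q / (b * c)) q p N = E1
  generalize thetaPoch (a * q / (b * d)) q p N = E2
  generalize thetaPoch (a * q / (c * d)) q p N = E3
  generalize theta (a * z / (b * c)) p = v1 at *
  generalize theta (a * z / (b * d)) p = v2 at *
  generalize theta (a * z / (c * d)) p = v3 at *
  generalize theta b p = v4 at *
  generalize theta c p = v5 at *
  generalize theta d p = v6 at *
  obtain rfl : B2 = B1 * w9 / w8 := by field_simp; rw [← c2]; ring
  obtain rfl : C2 = C1 * w11 / w10 := by field_simp; rw [← c3]; ring
  obtain rfl : D2 = D1 * w13 / w12 := by field_simp; rw [← c4]; ring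
  have c5' : G2 = w14 * G1 * q / (z * w2) := by
    field_simp
    field_simp at c5
    linear_combination c5
  trans A1 * E1 * E2 * E3 / (B1 * C1 * D1 * G1)
    * ((w5 * v1 * (v2 * v3) - w9 * w11 * (w13 * (-(z / g) * w3)))
      / (w9 * w11 * w13 * (-(z / g) * w3)))
  · field_simp
    ring
  rw [hw]
  trans -z⁻¹ * w1 * w14 / (w3 * w5 * w2 * w4) * q * (w7 * w6 * A2) * (v4 * v5 * v6)
    / (w8 * w10 * w12) * (E1 * E2 * E3)
    / (B1 * w9 / w8 * (C1 * w11 / w10) * (D1 * w13 / w12) * G2)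
  · rw [c1, c5']
    field_simp
  · ring

/-- The **Frenkel–Turaev summation**, the elliptic analogue of Jackson's sum. Three of the upper
parameters are `b, c, d`; the remaining two are `a q ^ (N + 1) / g` and `q ^ (-N)`. -/
theorem frenkel_turaev {q p : ℂ} (hp : ‖p‖ < 1) (hp0 : p ≠ 0) (hq : q ≠ 0) (N : ℕ)
    (hqN : thetaPoch q q p N ≠ 0) : ∀ {a b c d g : ℂ}, a ≠ 0 → b ≠ 0 → c ≠ 0 → d ≠ 0 →
    g * a = b * c * d → ThetaGeneric a q p → ThetaGeneric (a / b) q p →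
    ThetaGeneric (a / c) q p → ThetaGeneric (a / d) q p → ThetaGeneric g q p →
    ∑ k ∈ Finset.range (N + 1), ftBase a b c d q p k * ftTail a g (q ^ (N + 1)) q p k
      = ftValue a b c d g q p N := by
  induction N with
  | zero =>
    intro a b c d g _ _ _ _ _ hGa _ _ _ _
    simp [ftBase_zero hGa.theta_ne_zero, ftTail_zero, ftValue, thetaPoch_zero]
  | succ N ih =>
    intro a b c d g ha hb hc hd hg hGa hGb hGc hGd hGg
    have hqN' : thetaPoch q q p N ≠ 0 := by
      rw [thetaPoch_succ] at hqN; exact left_ne_zero_of_mul hqN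
    have hg0 : g ≠ 0 := by
      rintro rfl
      rw [zero_mul] at hg
      exact mul_ne_zero (mul_ne_zero hb hc) hd hg.symm
    have hz : q ^ (N + 1) ≠ 0 := pow_ne_zero _ hq
    have hGz : ThetaGeneric (g / q ^ (N + 1)) q p := by
      have := hGg.mul_zpow hq (-((N + 1 : ℕ) : ℤ))
      rwa [zpow_neg, zpow_natCast] at this
    have hGaz : ThetaGeneric (a * q ^ (N + 1)) q p := hGa.mul_pow hq _
    have ih' := ih hqN' (a := a * q ^ 2) (b := b * q) (c := c * q) (d := d * q) (g := g * q)
      (by positivity) (by positivity) (by positivity) (by positivity)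
      (by linear_combination q ^ 3 * hg) (hGa.mul_pow hq 2)
      (by rw [show a * q ^ 2 / (b * q) = a / b * q by field_simp]; exact hGb.mul hq)
      (by rw [show a * q ^ 2 / (c * q) = a / c * q by field_simp]; exact hGc.mul hq)
      (by rw [show a * q ^ 2 / (d * q) = a / d * q by field_simp]; exact hGd.mul hq)
      (hGg.mul hq)
    have hv := ftValue_succ hp hp0 ha hb hc hd hg0 hq hg hGa hGb hGc hGd hGg N rfl
    rw [← ih', ← ih hqN' ha hb hc hd hg hGa hGb hGc hGd hGg, Finset.mul_sum] at hv
    -- the last summand of the shorter sum continues by zero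
    have h0 : ∑ k ∈ Finset.range (N + 1), ftBase a b c d q p k * ftTail a g (q ^ (N + 1)) q p k
        = ∑ k ∈ Finset.range (N + 1),
            ftBase a b c d q p (k + 1) * ftTail a g (q ^ (N + 1)) q p (k + 1) + 1 := by
      have := Finset.sum_range_succ
        (fun k => ftBase a b c d q p k * ftTail a g (q ^ (N + 1)) q p k) (N + 1)
      rw [ftTail_eq_zero hp hq, mul_zero, add_zero] at this
      rw [← this, Finset.sum_range_succ', ftTail_zero, ftBase_zero hGa.theta_ne_zero, one_mul]
    rw [eq_add_of_sub_eq hv, Finset.sum_range_succ' _ (N + 1), h0, ftTail_zero,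
      ftBase_zero hGa.theta_ne_zero, one_mul, ← add_assoc, ← Finset.sum_add_distrib]
    congr 1
    refine Finset.sum_congr rfl fun k hk => ?_
    have hqk : thetaPoch q q p (k + 1) ≠ 0 := by
      refine fun h => hqN ?_
      rw [thetaPoch, Finset.prod_eq_zero_iff] at h ⊢
      obtain ⟨i, hi, h⟩ := h
      exact ⟨i, by simp only [Finset.mem_range] at *; omega, h⟩
    have h1 := ftTail_succ_sub hp hp0 ha hg0 hz hq hGaz hGz k
    have h2 := ftBase_succ hb hc hd hq hGa hGb hGc hGd hqk
    rw [← pow_succ q (N + 1)] at h1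
    rw [← sub_eq_iff_eq_add, ← mul_sub, h1]
    linear_combination (-(q ^ (N + 1))⁻¹ * theta (a * (q ^ (N + 1)) ^ 2 / g) p * theta g p
          / (theta (g / q ^ (N + 1)) p * theta (a * q ^ (N + 1)) p * theta (g / q ^ (N + 1) * q) p
            * theta (a * q ^ (N + 1) * q) p))
        * ftTail (a * q ^ 2) (g * q) (q ^ (N + 1)) q p k * h2

/-! ### Reversal and splitting of theta shifted factorials -/

theorem norm_sq_lt_one {p : ℂ} (hp : ‖p‖ < 1) : ‖p ^ 2‖ < 1 := by
  rw [norm_pow]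
  exact pow_lt_one₀ (norm_nonneg p) hp two_ne_zero

theorem thetaPoch_ne_zero_of_le {x q p : ℂ} {m n : ℕ} (h : m ≤ n) (hn : thetaPoch x q p n ≠ 0) :
    thetaPoch x q p m ≠ 0 := by
  obtain ⟨k, rfl⟩ := Nat.exists_eq_add_of_le h
  rw [thetaPoch_add] at hn
  exact left_ne_zero_of_mul hn

theorem thetaPoch_sq {x q p : ℂ} (hp : ‖p‖ < 1) (k : ℕ) :
    thetaPoch (x ^ 2) (q ^ 2) (p ^ 2) k = thetaPoch x q p k * thetaPoch (-x) q p k := by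
  rw [thetaPoch, thetaPoch, thetaPoch, ← Finset.prod_mul_distrib]
  refine Finset.prod_congr rfl fun i _ => ?_
  rw [← pow_mul, mul_comm 2 i, pow_mul, ← mul_pow, theta_sq hp, neg_mul]

theorem thetaPoch_eq_mul_thetaPoch_nome_sq {x q p : ℂ} (hp : ‖p‖ < 1) (k : ℕ) :
    thetaPoch x q p k = thetaPoch x q (p ^ 2) k * thetaPoch (x * p) q (p ^ 2) k := by
  rw [thetaPoch, thetaPoch, thetaPoch, ← Finset.prod_mul_distrib]
  refine Finset.prod_congr rfl fun i _ => ?_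
  rw [theta_eq_mul_theta_nome_sq hp, mul_right_comm]

theorem thetaPoch_reverse {x q p : ℂ} (hp : ‖p‖ < 1) (hx : x ≠ 0) (hq : q ≠ 0) (N : ℕ) :
    ∀ m ≤ N, thetaPoch (q / (q ^ N * x)) q p m * thetaPoch x q p (N - m)
      = thetaPoch x q p N * x⁻¹ ^ m * ∏ i ∈ Finset.range m, -(q ^ (N - 1 - i))⁻¹ := by
  intro m
  induction m with
  | zero => simp [thetaPoch_zero]
  | succ m ih =>
    intro hm
    have h := ih (by omega)
    obtain ⟨l, rfl⟩ : ∃ l, N = m + 1 + l := Nat.exists_eq_add_of_le hm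
    rw [show m + 1 + l - m = l + 1 by omega, thetaPoch_succ x] at h
    rw [Finset.prod_range_succ, show m + 1 + l - (m + 1) = l by omega,
      show m + 1 + l - 1 - m = l by omega, thetaPoch_succ,
      show q / (q ^ (m + 1 + l) * x) * q ^ m = (x * q ^ l)⁻¹ by
        rw [pow_add, pow_add]; field_simp,
      theta_inv hp (by positivity)]
    rw [pow_succ, mul_inv]
    linear_combination (-x⁻¹ * (q ^ l)⁻¹) * h

/-- A ratio of shifted factorials of length `N - m`, rewritten with length `m`. -/
theorem thetaPoch_sub_div {x y q p : ℂ} (hp : ‖p‖ < 1) (hx : x ≠ 0) (hy : y ≠ 0) (hq : q ≠ 0)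
    {N m : ℕ} (hm : m ≤ N) (hxN : thetaPoch x q p N ≠ 0) (hyN : thetaPoch y q p N ≠ 0) :
    thetaPoch x q p (N - m) / thetaPoch y q p (N - m)
      = thetaPoch x q p N / thetaPoch y q p N
        * (thetaPoch (q / (q ^ N * y)) q p m / thetaPoch (q / (q ^ N * x)) q p m)
        * (y / x) ^ m := by
  have h1 := thetaPoch_reverse hp hx hq N m hm
  have h2 := thetaPoch_reverse hp hy hq N m hm
  have hc : ∏ i ∈ Finset.range m, -(q ^ (N - 1 - i))⁻¹ ≠ 0 :=
    Finset.prod_ne_zero_iff.2 fun i _ => neg_ne_zero.2 (inv_ne_zero (pow_ne_zero _ hq))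
  have n1 : thetaPoch (q / (q ^ N * x)) q p m ≠ 0 := by
    refine left_ne_zero_of_mul (b := thetaPoch x q p (N - m)) ?_
    rw [h1]
    exact mul_ne_zero (mul_ne_zero hxN (pow_ne_zero _ (inv_ne_zero hx))) hc
  have n2 := thetaPoch_ne_zero_of_le (Nat.sub_le N m) hyN
  rw [div_pow, div_mul_div_comm, div_mul_div_comm, div_eq_div_iff n2 (by positivity)]
  rw [inv_pow] at h1 h2
  generalize ∏ i ∈ Finset.range m, -(q ^ (N - 1 - i))⁻¹ = c at *
  field_simp at h1 h2
  refine mul_right_cancel₀ hc ?_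
  linear_combination thetaPoch y q p N * c * h1 - thetaPoch x q p N * c * h2

theorem thetaPoch_reverse_div {x y q p : ℂ} (hp : ‖p‖ < 1) (hx : x ≠ 0) (hy : y ≠ 0) (hq : q ≠ 0)
    {N : ℕ} (hxN : thetaPoch x q p N ≠ 0) (hyN : thetaPoch y q p N ≠ 0) :
    thetaPoch (q / (q ^ N * x)) q p N / thetaPoch (q / (q ^ N * y)) q p N
      = thetaPoch x q p N / thetaPoch y q p N * (y / x) ^ N := by
  have h1 := thetaPoch_reverse hp hx hq N N le_rfl
  have h2 := thetaPoch_reverse hp hy hq N N le_rfl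
  have hc : ∏ i ∈ Finset.range N, -(q ^ (N - 1 - i))⁻¹ ≠ 0 :=
    Finset.prod_ne_zero_iff.2 fun i _ => neg_ne_zero.2 (inv_ne_zero (pow_ne_zero _ hq))
  rw [Nat.sub_self, thetaPoch_zero, mul_one] at h1 h2
  rw [h1, h2, div_pow, inv_pow, inv_pow]
  generalize ∏ i ∈ Finset.range N, -(q ^ (N - 1 - i))⁻¹ = c at *
  field_simp

/-! ### Elliptic Bailey matrices -/

/-- The elliptic Bailey matrix relative to `(a, k)`, for row `n` and column `j ≤ n`. -/
noncomputable def baileyM (a k q p : ℂ) (n j : ℕ) : ℂ :=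
  thetaPoch (k / a) q p (n - j) * thetaPoch k q p (n + j)
    / (thetaPoch q q p (n - j) * thetaPoch (a * q) q p (n + j))

/-- The inverse of the elliptic Bailey matrix, for row `j` and column `i ≤ j`. -/
noncomputable def baileyL (a k q p : ℂ) (j i : ℕ) : ℂ :=
  theta (a * q ^ (2 * j)) p / theta a p * (theta (k * q ^ (2 * i)) p / theta k p)
    * (thetaPoch a q p (j + i) * thetaPoch (a / k) q p (j - i)
      / (thetaPoch (k * q) q p (j + i) * thetaPoch q q p (j - i))) * (k / a) ^ (j - i)

theorem baileyM_eq {a k q p : ℂ} (hp : ‖p‖ < 1) (ha : a ≠ 0) (hk : k ≠ 0) (hq : q ≠ 0) {n j : ℕ}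
    (hj : j ≤ n) (hka : thetaPoch (k / a) q p n ≠ 0) (hqn : thetaPoch q q p n ≠ 0) :
    baileyM a k q p n j = baileyM a k q p n 0
      * (thetaPoch (k * q ^ n) q p j * thetaPoch (q / q ^ (n + 1)) q p j
        / (thetaPoch (q * a / (k * q ^ n)) q p j * thetaPoch (a * q ^ (n + 1)) q p j))
      * (q * a / k) ^ j := by
  have h := thetaPoch_sub_div hp (div_ne_zero hk ha) hq hq hj hka hqn
  simp only [baileyM]
  rw [mul_div_mul_comm, h, thetaPoch_add k, thetaPoch_add (a * q),
    show q / (q ^ n * q) = q / q ^ (n + 1) by rw [pow_succ],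
    show q / (q ^ n * (k / a)) = q * a / (k * q ^ n) by field_simp,
    show q / (k / a) = q * a / k by field_simp, show a * q * q ^ n = a * q ^ (n + 1) by ring]
  simp only [Nat.sub_zero, Nat.add_zero]
  ring

/-- The orthogonality relation behind the inversion of the Bailey matrix: a Frenkel–Turaev sum
whose value contains the factor `(1; q, p)_N`. -/
theorem sum_baileyM_mul_baileyL_zero {a k q p : ℂ} (hp : ‖p‖ < 1) (hp0 : p ≠ 0) (ha : a ≠ 0)
    (hk : k ≠ 0) (hq : q ≠ 0) (hGa : ThetaGeneric a q p) (hGk : ThetaGeneric k q p)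
    (hGak : ThetaGeneric (a * k) q p) (hGadk : ThetaGeneric (a / k) q p) {N : ℕ} (hN : N ≠ 0)
    (hqN : thetaPoch q q p N ≠ 0) :
    ∑ m ∈ Finset.range (N + 1), baileyM a k q p N m * (theta (a * q ^ (2 * m)) p / theta a p
      * (thetaPoch a q p m * thetaPoch (a / k) q p m
        / (thetaPoch (k * q) q p m * thetaPoch q q p m)) * (k / a) ^ m) = 0 := by
  have hka : ThetaGeneric (k / a) q p := by
    rw [← inv_div]; exact hGadk.inv hp (div_ne_zero ha hk) hq
  have hGki := hGk.inv hp hk hq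
  have ft := frenkel_turaev hp hp0 hq N hqN (a := a) (b := a / k) (c := a * k) (d := q / k)
    (g := a * q / k) ha (by positivity) (by positivity) (by positivity) (by field_simp) hGa
    (by rwa [div_div_cancel₀ ha]) (by rwa [show a / (a * k) = k⁻¹ by field_simp])
    (by
      have := hGak.mul_zpow hq (-1)
      rwa [show a * k * q ^ (-1 : ℤ) = a / (q / k) by rw [zpow_neg_one]; field_simp] at this)
    (by rw [mul_div_right_comm]; exact hGadk.mul hq)
  have hv : ftValue a (a / k) (a * k) (q / k) (a * q / k) q p N = 0 := by
    have : thetaPoch (a * q / (a * k * (q / k))) q p N = 0 := by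
      rw [show a * q / (a * k * (q / k)) = 1 by field_simp]
      obtain ⟨M, rfl⟩ := Nat.exists_eq_succ_of_ne_zero hN
      rw [Nat.succ_eq_add_one, thetaPoch_succ', theta_one hp, zero_mul]
    rw [ftValue, this]
    simp
  rw [hv] at ft
  rw [← mul_zero (baileyM a k q p N 0), ← ft, Finset.mul_sum]
  refine Finset.sum_congr rfl fun m hm => ?_
  rw [baileyM_eq hp ha hk hq (by simpa [Nat.lt_succ_iff] using hm) (hka.thetaPoch_ne_zero N) hqN]
  have n1 : thetaPoch (q / k) q p m ≠ 0 := by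
    rw [div_eq_inv_mul]; exact (hGki.mul hq).thetaPoch_ne_zero m
  have n2 : thetaPoch (a * k) q p m ≠ 0 := hGak.thetaPoch_ne_zero m
  simp only [ftBase, ftTail]
  rw [show a * q / (a / k) = k * q by field_simp, show a * q / (a * k) = q / k by field_simp,
    show a * q / (q / k) = a * k by field_simp,
    show a * q ^ (N + 1) / (a * q / k) = k * q ^ N by rw [pow_succ]; field_simp,
    show a * q / k * q / q ^ (N + 1) = q * a / (k * q ^ N) by rw [pow_succ]; field_simp]
  have e : (q * a / k) ^ m * (k / a) ^ m = q ^ m := by rw [← mul_pow]; congr 1; field_simp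
  generalize thetaPoch (q / k) q p m = X at *
  generalize thetaPoch (a * k) q p m = Y at *
  rw [← e]
  trans baileyM a k q p N 0 *
      (thetaPoch (k * q ^ N) q p m * thetaPoch (q / q ^ (N + 1)) q p m /
        (thetaPoch (q * a / (k * q ^ N)) q p m * thetaPoch (a * q ^ (N + 1)) q p m)) *
    (theta (a * q ^ (2 * m)) p / theta a p *
        (thetaPoch a q p m * thetaPoch (a / k) q p m / (thetaPoch (k * q) q p m * thetaPoch q q p m)))
    * ((q * a / k) ^ m * (k / a) ^ m) * (X * X⁻¹) * (Y * Y⁻¹)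
  · rw [mul_inv_cancel₀ n1, mul_inv_cancel₀ n2]
    ring
  · ring

theorem sum_baileyM_mul_baileyL {a k q p : ℂ} (hp : ‖p‖ < 1) (hp0 : p ≠ 0) (ha : a ≠ 0)
    (hk : k ≠ 0) (hq : q ≠ 0) (hGa : ThetaGeneric a q p) (hGk : ThetaGeneric k q p)
    (hGak : ThetaGeneric (a * k) q p) (hGadk : ThetaGeneric (a / k) q p) {i n : ℕ} (hi : i ≤ n)
    (hqN : thetaPoch q q p n ≠ 0) :
    ∑ j ∈ Finset.Ico i (n + 1), baileyM a k q p n j * baileyL a k q p j i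
      = if i = n then 1 else 0 := by
  split_ifs with h
  · subst h
    have e1 : thetaPoch k q p (i + i) * theta (k * q ^ (2 * i)) p
        = theta k p * thetaPoch (k * q) q p (i + i) := by
      rw [← thetaPoch_succ', thetaPoch_succ, two_mul]
    have e2 : thetaPoch a q p (i + i) * theta (a * q ^ (2 * i)) p
        = theta a p * thetaPoch (a * q) q p (i + i) := by
      rw [← thetaPoch_succ', thetaPoch_succ, two_mul]
    have n1 := (hGk.mul hq).thetaPoch_ne_zero (i + i)
    have n2 := (hGa.mul hq).thetaPoch_ne_zero (i + i)
    have n3 := hGk.theta_ne_zero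
    have n4 := hGa.theta_ne_zero
    rw [Nat.Ico_succ_singleton, Finset.sum_singleton]
    simp only [baileyM, baileyL, Nat.sub_self, thetaPoch_zero, pow_zero, mul_one, one_mul]
    generalize thetaPoch (k * q) q p (i + i) = X at *
    generalize thetaPoch (a * q) q p (i + i) = Y at *
    generalize theta (a * q ^ (2 * i)) p = u at *
    generalize theta (k * q ^ (2 * i)) p = v at *
    field_simp
    linear_combination u * thetaPoch a q p (i + i) * e1 + theta k p * X * e2
  · obtain ⟨N, rfl⟩ := Nat.exists_eq_add_of_le hi
    have hN : N ≠ 0 := by rintro rfl; exact h rfl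
    have key := sum_baileyM_mul_baileyL_zero hp hp0 (a := a * q ^ (2 * i)) (k := k * q ^ (2 * i))
      (by positivity) (by positivity) hq (hGa.mul_pow hq _) (hGk.mul_pow hq _)
      (by
        rw [show a * q ^ (2 * i) * (k * q ^ (2 * i)) = a * k * q ^ (4 * i) by ring]
        exact hGak.mul_pow hq _)
      (by rwa [mul_div_mul_right _ _ (by positivity)]) hN
      (thetaPoch_ne_zero_of_le (Nat.le_add_left N i) hqN)
    rw [Finset.sum_Ico_eq_sum_range, show i + N + 1 - i = N + 1 by omega]
    rw [← mul_zero (thetaPoch k q p (2 * i) / thetaPoch (a * q) q p (2 * i)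
      * (theta (a * q ^ (2 * i)) p / theta a p) * (theta (k * q ^ (2 * i)) p / theta k p)
      * (thetaPoch a q p (2 * i) / thetaPoch (k * q) q p (2 * i))), ← key, Finset.mul_sum]
    refine Finset.sum_congr rfl fun m hm => ?_
    have n4 : theta (a * q ^ (2 * i)) p ≠ 0 := (hGa.mul_pow hq _).theta_ne_zero
    simp only [baileyM, baileyL]
    rw [mul_div_mul_right k a (by positivity : q ^ (2 * i) ≠ 0),
      mul_div_mul_right a k (by positivity : q ^ (2 * i) ≠ 0),
      show i + N - (i + m) = N - m by omega, show i + N + (i + m) = 2 * i + (N + m) by omega,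
      show i + m + i = 2 * i + m by omega, show i + m - i = m by omega,
      thetaPoch_add k, thetaPoch_add (a * q), thetaPoch_add a, thetaPoch_add (k * q),
      show a * q * q ^ (2 * i) = a * q ^ (2 * i) * q by ring,
      show k * q * q ^ (2 * i) = k * q ^ (2 * i) * q by ring,
      show a * q ^ (2 * i) * q ^ (2 * m) = a * q ^ (2 * (i + m)) by ring]
    generalize theta (a * q ^ (2 * i)) p = X at *
    rw [← mul_one (_ * (_ * _)), ← mul_inv_cancel₀ n4]
    ring

/-! ### The two summations behind the transformation -/

theorem thetaPoch_nome_reverse {x q p : ℂ} (hp0 : p ≠ 0) (hx : x ≠ 0) (hq : q ≠ 0) (N : ℕ) :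
    thetaPoch (p * q / (q ^ N * x)) q p N = thetaPoch x q p N := by
  rw [thetaPoch, thetaPoch, ← Finset.prod_range_reflect]
  refine Finset.prod_congr rfl fun i hi => ?_
  obtain ⟨l, rfl⟩ := Nat.exists_eq_add_of_lt (Finset.mem_range.1 hi)
  rw [show i + l + 1 - 1 - i = l by omega, ← theta_nome_div hp0 (x * q ^ i)]
  congr 1
  rw [pow_add, pow_add]
  field_simp

/-- A Frenkel–Turaev sum in nome `s²` whose summand involves a Bailey matrix of nome `s`. -/
theorem sum_baileyM_mul_unit {B k a Q s : ℂ} (hs : ‖s‖ < 1) (hs0 : s ≠ 0) (hB : B ≠ 0)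
    (hk : k ≠ 0) (ha : a ≠ 0) (hQ : Q ≠ 0) (h : a ^ 2 = B * k * Q)
    (hBQ : ThetaGeneric B Q (s ^ 2)) (hBs : ThetaGeneric (B * s) Q (s ^ 2))
    (hks : ThetaGeneric (k * s) Q (s ^ 2)) (hBa : ThetaGeneric (B * s / a) Q (s ^ 2))
    (hak : ThetaGeneric (a / k) Q (s ^ 2)) (hkQ : ThetaGeneric k Q (s ^ 2))
    (hB' : ThetaGeneric (a / B) Q s) {j : ℕ} (hQj : thetaPoch Q Q s j ≠ 0) :
    ∑ m ∈ Finset.range (j + 1), baileyM B a Q s j m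
      * (theta (B * s * Q ^ (2 * m)) (s ^ 2) / theta (B * s) (s ^ 2)
        * (thetaPoch (B * s) Q (s ^ 2) m * thetaPoch (B / k) Q (s ^ 2) m
          / (thetaPoch Q Q (s ^ 2) m * thetaPoch (k * s * Q) Q (s ^ 2) m)) * (a / B) ^ m)
      = thetaPoch a Q s j * thetaPoch (a / k) Q s j / (thetaPoch Q Q s j * thetaPoch (k * Q) Q s j)
        * (thetaPoch (k * Q) Q (s ^ 2) (2 * j) / thetaPoch (B * Q) Q (s ^ 2) (2 * j)) := by
  have hs2 := norm_sq_lt_one hs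
  have hs20 : s ^ 2 ≠ 0 := pow_ne_zero 2 hs0
  have hQj2 : thetaPoch Q Q (s ^ 2) j ≠ 0 := by
    rw [thetaPoch_eq_mul_thetaPoch_nome_sq hs] at hQj
    exact left_ne_zero_of_mul hQj
  have ft := frenkel_turaev hs2 hs20 hQ j hQj2 (a := B * s) (b := B / k) (c := s / Q ^ j)
    (d := a * Q ^ j) (g := a / k) (by positivity) (by positivity) (by positivity) (by positivity)
    (by field_simp) hBs (by rwa [show B * s / (B / k) = k * s by field_simp])
    (by rw [show B * s / (s / Q ^ j) = B * Q ^ j by field_simp]; exact hBQ.mul_pow hQ j)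
    (by
      have := hBa.mul_zpow hQ (-(j : ℤ))
      rwa [show B * s / a * Q ^ (-(j : ℤ)) = B * s / (a * Q ^ j) by
        rw [zpow_neg, zpow_natCast]; field_simp] at this) hak
  have hterm : ∀ m ∈ Finset.range (j + 1), baileyM B a Q s j m
      * (theta (B * s * Q ^ (2 * m)) (s ^ 2) / theta (B * s) (s ^ 2)
        * (thetaPoch (B * s) Q (s ^ 2) m * thetaPoch (B / k) Q (s ^ 2) m
          / (thetaPoch Q Q (s ^ 2) m * thetaPoch (k * s * Q) Q (s ^ 2) m)) * (a / B) ^ m)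
      = baileyM B a Q s j 0 * (ftBase (B * s) (B / k) (s / Q ^ j) (a * Q ^ j) Q (s ^ 2) m
        * ftTail (B * s) (a / k) (Q ^ (j + 1)) Q (s ^ 2) m) := by
    intro m hm
    rw [baileyM_eq hs hB ha hQ (by simpa [Nat.lt_succ_iff] using hm) (hB'.thetaPoch_ne_zero j) hQj]
    simp only [thetaPoch_eq_mul_thetaPoch_nome_sq hs (q := Q), ftBase, ftTail]
    rw [show B * s * Q / (B / k) = k * s * Q by field_simp,
      show B * s * Q / (s / Q ^ j) = B * Q ^ (j + 1) by rw [pow_succ]; field_simp,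
      show B * s * Q / (a * Q ^ j) = Q * B / (a * Q ^ j) * s by ring,
      show B * s * Q ^ (j + 1) / (a / k) = a * Q ^ j * s by
        rw [pow_succ]; field_simp; linear_combination -h,
      show a / k * Q / Q ^ (j + 1) = Q * B / (a * Q ^ j) by
        rw [pow_succ]; field_simp; linear_combination h,
      show s / Q ^ j = Q / Q ^ (j + 1) * s by rw [pow_succ]; field_simp,
      show B * s * Q ^ (j + 1) = B * Q ^ (j + 1) * s by ring]
    have e : (Q * B / a) ^ m * (a / B) ^ m = Q ^ m := by rw [← mul_pow]; congr 1; field_simp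
    rw [← e]
    ring
  rw [Finset.sum_congr rfl hterm, ← Finset.mul_sum, ft]
  have r1 := thetaPoch_nome_reverse hs20 (x := a * s / k) (by positivity) hQ j
  have r2 := thetaPoch_nome_reverse hs20 (x := a * s / B) (by positivity) hQ j
  rw [show s ^ 2 * Q / (Q ^ j * (a * s / k)) = k * s * Q / (a * Q ^ j) by field_simp] at r1
  rw [show s ^ 2 * Q / (Q ^ j * (a * s / B)) = B * s * Q / (a * Q ^ j) by field_simp] at r2
  simp only [baileyM, ftValue, Nat.sub_zero, Nat.add_zero]
  rw [show B * s * Q / (B / k * (s / Q ^ j)) = k * Q * Q ^ j by field_simp,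
    show B * s * Q / (B / k * (a * Q ^ j)) = k * s * Q / (a * Q ^ j) by field_simp,
    show B * s * Q / (s / Q ^ j * (a * Q ^ j)) = a / k by field_simp; linear_combination -h,
    show B * s * Q / (B / k) = k * Q * s by field_simp,
    show B * s * Q / (s / Q ^ j) = B * Q * Q ^ j by field_simp,
    show Q / (a / k) = a / B by field_simp; linear_combination -h, r1, r2,
    thetaPoch_eq_mul_thetaPoch_nome_sq hs (x := a / B),
    thetaPoch_eq_mul_thetaPoch_nome_sq hs (x := B * Q),
    thetaPoch_eq_mul_thetaPoch_nome_sq hs (x := a / k),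
    thetaPoch_eq_mul_thetaPoch_nome_sq hs (x := k * Q),
    two_mul, thetaPoch_add, thetaPoch_add, show a / B * s = a * s / B by ring,
    show a / k * s = a * s / k by ring, show B * s * Q = B * Q * s by ring]
  have hBa' : ThetaGeneric (a * s / B) Q (s ^ 2) := fun i => by
    have := hB' i
    rw [theta_eq_mul_theta_nome_sq hs] at this
    rw [show a * s / B * Q ^ i = a / B * Q ^ i * s by ring]
    exact right_ne_zero_of_mul this
  have hBa'' : ThetaGeneric (a / B) Q (s ^ 2) := fun i => by
    have := hB' i
    rw [theta_eq_mul_theta_nome_sq hs] at this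
    exact left_ne_zero_of_mul this
  have n1 := hBa'.thetaPoch_ne_zero j
  have n2 := hBa''.thetaPoch_ne_zero j
  have n3 : thetaPoch (B * Q * s) Q (s ^ 2) j ≠ 0 := by
    rw [mul_right_comm]; exact (hBs.mul hQ).thetaPoch_ne_zero j
  have n4 : thetaPoch (k * Q * s) Q (s ^ 2) j ≠ 0 := by
    rw [mul_right_comm]; exact (hks.mul hQ).thetaPoch_ne_zero j
  have n5 := (hBQ.mul hQ).thetaPoch_ne_zero j
  have n6 := ((hBQ.mul hQ).mul_pow hQ j).thetaPoch_ne_zero j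
  have n7 := (hkQ.mul hQ).thetaPoch_ne_zero j
  generalize thetaPoch (a * s / B) Q (s ^ 2) j = x1 at *
  generalize thetaPoch (a / B) Q (s ^ 2) j = x2 at *
  generalize thetaPoch (B * Q * s) Q (s ^ 2) j = x3 at *
  generalize thetaPoch (k * Q * s) Q (s ^ 2) j = x4 at *
  generalize thetaPoch (B * Q) Q (s ^ 2) j = x5 at *
  generalize thetaPoch (B * Q * Q ^ j) Q (s ^ 2) j = x6 at *
  generalize thetaPoch (k * Q) Q (s ^ 2) j = x7 at *
  generalize thetaPoch (k * Q * Q ^ j) Q (s ^ 2) j = x8 at *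
  generalize thetaPoch a Q s j = x9 at *
  generalize thetaPoch Q Q s j = x10 at *
  generalize thetaPoch (a / k) Q (s ^ 2) j = x11 at *
  generalize thetaPoch (a * s / k) Q (s ^ 2) j = x12 at *
  field_simp

/-- A Frenkel–Turaev sum in base `q` and nome `p` whose summand involves shifted factorials in base
`q²` and nome `p²`. -/
theorem sum_quadratic {κ b q p : ℂ} (hp : ‖p‖ < 1) (hp0 : p ≠ 0) (hκ : κ ≠ 0) (hb : b ≠ 0)
    (hq : q ≠ 0) (hGκ : ThetaGeneric κ q p) (hGκ' : ThetaGeneric (-κ) q p)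
    (hGb : ThetaGeneric b q p) (hGb' : ThetaGeneric (-b) q p)
    (hGκb : ThetaGeneric (κ * q / b) (q ^ 2) (p ^ 2)) (hGbκ : ThetaGeneric (b * q / κ) (q ^ 2) (p ^ 2))
    {N : ℕ} (hqN : thetaPoch (q ^ 2) (q ^ 2) (p ^ 2) N ≠ 0) :
    ∑ m ∈ Finset.range (N + 1), theta (κ ^ 2 * q ^ (4 * m)) (p ^ 2) / theta (-κ * q ^ (2 * m)) p
      * (q⁻¹ ^ m * (κ / (b * q)) ^ (N - m))
      * (thetaPoch κ q p m * thetaPoch (κ / b) q p m / (thetaPoch q q p m * thetaPoch (b * q) q p m))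
      * (thetaPoch (b * κ * q) (q ^ 2) (p ^ 2) (N + m) * thetaPoch (b * q / κ) (q ^ 2) (p ^ 2) (N - m)
        / (thetaPoch (κ ^ 2 * q ^ 2) (q ^ 2) (p ^ 2) (N + m)
          * thetaPoch (q ^ 2) (q ^ 2) (p ^ 2) (N - m)))
      = theta κ p * q⁻¹ ^ N
        * (thetaPoch (b * κ * q) (q ^ 2) (p ^ 2) N * thetaPoch (κ * q / b) (q ^ 2) (p ^ 2) N
          / (thetaPoch (κ ^ 2 * q ^ 2) (q ^ 2) (p ^ 2) N * thetaPoch (q ^ 2) (q ^ 2) (p ^ 2) N))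
        * (thetaPoch (κ * q) q p N * thetaPoch (-b * q ^ (N + 1)) q p N
          / (thetaPoch (b * q) q p N * thetaPoch (-κ * q ^ (N + 1)) q p N)) := by
  have hp2 := norm_sq_lt_one hp
  have hq2 : q ^ 2 ≠ 0 := pow_ne_zero 2 hq
  obtain ⟨σ, hσ⟩ : ∃ r, r ^ 2 = b * κ * q * q ^ (2 * N) := IsAlgClosed.exists_pow_nat_eq _ two_pos
  have hσ0 : σ ≠ 0 := by
    rintro rfl
    rw [zero_pow two_ne_zero] at hσ
    have : b * κ * q * q ^ (2 * N) ≠ 0 := by positivity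
    exact this hσ.symm
  have hqN1 : thetaPoch q q p N ≠ 0 := by
    rw [thetaPoch_sq hp] at hqN; exact left_ne_zero_of_mul hqN
  have hsplit : ∀ i : ℤ, theta (κ / σ * q ^ i) p * theta (κ / -σ * q ^ i) p ≠ 0 := by
    intro i
    have e : κ / -σ * q ^ i = -(κ / σ * q ^ i) := by rw [div_neg, neg_mul]
    have := hGκb (i - (N + 1 : ℕ))
    rw [e, ← theta_sq hp]
    convert this using 2
    rw [mul_pow, div_pow, hσ, zpow_sub₀ hq2, zpow_natCast, ← zpow_natCast (q ^ i), ← zpow_mul,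
      ← zpow_natCast q 2, ← zpow_mul, mul_comm i]
    rw [← zpow_natCast q (2 * N), ← zpow_natCast _ (N + 1), ← zpow_mul]
    push_cast
    rw [mul_add, zpow_add₀ hq]
    field_simp
    simp
  have ft := frenkel_turaev hp hp0 hq N hqN1 (a := κ) (b := κ / b) (c := σ) (d := -σ)
    (g := -(κ * q * q ^ (2 * N))) hκ (by positivity) hσ0 (neg_ne_zero.2 hσ0)
    (by field_simp; rw [hσ]; ring) hGκ (by rwa [div_div_cancel₀ hκ])
    (fun i => left_ne_zero_of_mul (hsplit i)) (fun i => right_ne_zero_of_mul (hsplit i))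
    (by
      rw [show -(κ * q * q ^ (2 * N)) = -κ * q ^ (2 * N + 1) by ring]
      exact hGκ'.mul_pow hq _)
  have eσ : (κ * q / σ) ^ 2 = q ^ 2 / ((q ^ 2) ^ N * (b * q / κ)) := by
    rw [div_pow, hσ, ← pow_mul]; field_simp
  have eσ' : (b * q / σ) ^ 2 = q ^ 2 / ((q ^ 2) ^ N * (κ * q / b)) := by
    rw [div_pow, hσ, ← pow_mul]; field_simp
  have hterm : ∀ m ∈ Finset.range (N + 1),
      theta (κ ^ 2 * q ^ (4 * m)) (p ^ 2) / theta (-κ * q ^ (2 * m)) p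
      * (q⁻¹ ^ m * (κ / (b * q)) ^ (N - m))
      * (thetaPoch κ q p m * thetaPoch (κ / b) q p m / (thetaPoch q q p m * thetaPoch (b * q) q p m))
      * (thetaPoch (b * κ * q) (q ^ 2) (p ^ 2) (N + m) * thetaPoch (b * q / κ) (q ^ 2) (p ^ 2) (N - m)
        / (thetaPoch (κ ^ 2 * q ^ 2) (q ^ 2) (p ^ 2) (N + m)
          * thetaPoch (q ^ 2) (q ^ 2) (p ^ 2) (N - m)))
      = theta κ p * (κ / (b * q)) ^ N
        * (thetaPoch (b * κ * q) (q ^ 2) (p ^ 2) N * thetaPoch (b * q / κ) (q ^ 2) (p ^ 2) N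
          / (thetaPoch (κ ^ 2 * q ^ 2) (q ^ 2) (p ^ 2) N * thetaPoch (q ^ 2) (q ^ 2) (p ^ 2) N))
        * (ftBase κ (κ / b) σ (-σ) q p m
          * ftTail κ (-(κ * q * q ^ (2 * N))) (q ^ (N + 1)) q p m) := by
    intro m hm
    have hm' : m ≤ N := by simpa [Nat.lt_succ_iff] using hm
    have hr := thetaPoch_sub_div hp2 (div_ne_zero (mul_ne_zero hb hq) hκ) hq2 hq2 hm'
      (hGbκ.thetaPoch_ne_zero N) hqN
    have n1 : theta (-(κ * q ^ (2 * m))) p ≠ 0 := by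
      rw [← neg_mul]; exact (hGκ'.mul_pow hq _).theta_ne_zero
    have n2 := hGκ.theta_ne_zero
    rw [mul_div_mul_comm (thetaPoch (b * κ * q) (q ^ 2) (p ^ 2) (N + m)), hr,
      thetaPoch_add (b * κ * q), thetaPoch_add (κ ^ 2 * q ^ 2), ← eσ,
      show q ^ 2 / ((q ^ 2) ^ N * q ^ 2) = (q / q ^ (N + 1)) ^ 2 by
        rw [pow_succ q N]; field_simp; ring,
      show b * κ * q * (q ^ 2) ^ N = σ ^ 2 by rw [hσ, pow_mul],
      show κ ^ 2 * q ^ 2 * (q ^ 2) ^ N = (κ * q ^ (N + 1)) ^ 2 by ring,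
      thetaPoch_sq hp (x := q / q ^ (N + 1)), thetaPoch_sq hp (x := κ * q / σ),
      thetaPoch_sq hp (x := σ), thetaPoch_sq hp (x := κ * q ^ (N + 1)),
      show κ ^ 2 * q ^ (4 * m) = (κ * q ^ (2 * m)) ^ 2 by ring, theta_sq hp, neg_mul,
      mul_div_cancel_right₀ _ n1]
    simp only [ftBase, ftTail]
    rw [show κ * q / (κ / b) = b * q by field_simp, div_neg,
      show κ * q ^ (N + 1) / -(κ * q * q ^ (2 * N)) = -(q / q ^ (N + 1)) by
        rw [mul_comm 2 N, pow_mul, div_neg]; field_simp; ring,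
      show -(κ * q * q ^ (2 * N)) * q / q ^ (N + 1) = -(κ * q ^ (N + 1)) by
        rw [mul_comm 2 N, pow_mul, pow_succ]; field_simp; ring]
    have e : (κ / (b * q)) ^ (N - m) * (q⁻¹ ^ m * (q ^ 2 / (b * q / κ)) ^ m)
        = (κ / (b * q)) ^ N * q ^ m := by
      rw [pow_sub₀ _ (by positivity) hm', ← inv_pow, mul_assoc, ← mul_pow, ← mul_pow]
      congr 2
      field_simp
    have n3 : theta κ p * (theta κ p)⁻¹ = 1 := mul_inv_cancel₀ n2
    generalize thetaPoch κ q p m * thetaPoch (κ / b) q p m = x1 at *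
    generalize thetaPoch (b * κ * q) (q ^ 2) (p ^ 2) N = x2
    generalize thetaPoch (κ ^ 2 * q ^ 2) (q ^ 2) (p ^ 2) N = x3
    trans (κ / (b * q)) ^ (N - m) * (q⁻¹ ^ m * (q ^ 2 / (b * q / κ)) ^ m)
      * (theta (κ * q ^ (2 * m)) p * (x1 / (thetaPoch q q p m * thetaPoch (b * q) q p m))
      * (x2 / x3)
      * (thetaPoch σ q p m * thetaPoch (-σ) q p m
        / (thetaPoch (κ * q ^ (N + 1)) q p m * thetaPoch (-(κ * q ^ (N + 1))) q p m))
      * (thetaPoch (b * q / κ) (q ^ 2) (p ^ 2) N / thetaPoch (q ^ 2) (q ^ 2) (p ^ 2) N)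
      * (thetaPoch (q / q ^ (N + 1)) q p m * thetaPoch (-(q / q ^ (N + 1))) q p m
        / (thetaPoch (κ * q / σ) q p m * thetaPoch (-(κ * q / σ)) q p m)))
      * (theta κ p * (theta κ p)⁻¹)
    · rw [n3]
      ring
    · rw [e]
      ring
  rw [Finset.sum_congr rfl hterm, ← Finset.mul_sum, ft]
  have hκq : ThetaGeneric (-κ * q ^ (N + 1)) q p := hGκ'.mul_pow hq _
  have hbq : ThetaGeneric (-b * q ^ (N + 1)) q p := hGb'.mul_pow hq _
  have r1 := thetaPoch_reverse_div hp2 (x := κ * q / b) (y := b * q / κ) (by positivity)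
    (by positivity) hq2 (hGκb.thetaPoch_ne_zero N) (hGbκ.thetaPoch_ne_zero N)
  have r2 := thetaPoch_reverse_div hp (x := -b * q ^ (N + 1)) (y := -κ * q ^ (N + 1))
    (mul_ne_zero (neg_ne_zero.2 hb) (by positivity))
    (mul_ne_zero (neg_ne_zero.2 hκ) (by positivity)) hq
    (hbq.thetaPoch_ne_zero N) (hκq.thetaPoch_ne_zero N)
  rw [← eσ, ← eσ', thetaPoch_sq hp, thetaPoch_sq hp] at r1
  simp only [ftValue]
  rw [show κ * q / (κ / b * σ) = b * q / σ by field_simp,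
    show κ * q / (κ / b * -σ) = -(b * q / σ) by rw [mul_neg, div_neg]; field_simp,
    show κ * q / (σ * -σ) = q / (q ^ N * (-b * q ^ (N + 1))) by
      rw [mul_neg, ← sq, hσ, mul_comm 2 N, pow_mul]; field_simp; ring,
    show κ * q / (κ / b) = b * q by field_simp, div_neg,
    show q / -(κ * q * q ^ (2 * N)) = q / (q ^ N * (-κ * q ^ (N + 1))) by
      rw [mul_comm 2 N, pow_mul]; field_simp; ring]
  have n1 := hGbκ.thetaPoch_ne_zero N
  have e : (κ / (b * q)) ^ N * ((b * q / κ / (κ * q / b)) ^ N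
      * (-κ * q ^ (N + 1) / (-b * q ^ (N + 1))) ^ N) = q⁻¹ ^ N := by
    rw [← mul_pow, ← mul_pow]
    congr 1
    field_simp
  have n2 : thetaPoch (b * q / κ) (q ^ 2) (p ^ 2) N * (thetaPoch (b * q / κ) (q ^ 2) (p ^ 2) N)⁻¹
    = 1 := mul_inv_cancel₀ n1
  generalize thetaPoch (b * q / κ) (q ^ 2) (p ^ 2) N = x1 at *
  generalize thetaPoch (κ * q / b) (q ^ 2) (p ^ 2) N = x2 at *
  generalize thetaPoch (b * κ * q) (q ^ 2) (p ^ 2) N = x3 at *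
  generalize thetaPoch (κ ^ 2 * q ^ 2) (q ^ 2) (p ^ 2) N = x4 at *
  generalize thetaPoch (q ^ 2) (q ^ 2) (p ^ 2) N = x5 at *
  generalize thetaPoch (b * q / σ) q p N = y1 at *
  generalize thetaPoch (-(b * q / σ)) q p N = y2 at *
  generalize thetaPoch (κ * q / σ) q p N = y3 at *
  generalize thetaPoch (-(κ * q / σ)) q p N = y4 at *
  generalize thetaPoch (q / (q ^ N * (-b * q ^ (N + 1)))) q p N = y5 at *
  generalize thetaPoch (q / (q ^ N * (-κ * q ^ (N + 1)))) q p N = y6 at *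
  trans theta κ p * (κ / (b * q)) ^ N * (x3 * x1 / (x4 * x5))
    * (thetaPoch (κ * q) q p N / thetaPoch (b * q) q p N) * (y1 * y2 / (y3 * y4)) * (y5 / y6)
  · ring
  · rw [r1, r2, ← e]
    linear_combination theta κ p * (κ / (b * q)) ^ N * (x3 / (x4 * x5)) * x2
      * (thetaPoch (κ * q) q p N / thetaPoch (b * q) q p N)
      * (thetaPoch (-b * q ^ (N + 1)) q p N / thetaPoch (-κ * q ^ (N + 1)) q p N)
      * ((b * q / κ / (κ * q / b)) ^ N * (-κ * q ^ (N + 1) / (-b * q ^ (N + 1))) ^ N) * n2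

/-! ### The transformation for generic parameters -/

/-- The transition between the Bailey matrices of base `q`, nome `p` relative to `(b, K)` and of
base `q²`, nome `p²` relative to `(bKq, K²)`. -/
theorem sum_baileyL_mul_baileyM {b K q p : ℂ} (hp : ‖p‖ < 1) (hp0 : p ≠ 0) (hb : b ≠ 0)
    (hK : K ≠ 0) (hq : q ≠ 0) (hGK : ThetaGeneric K q p) (hGK' : ThetaGeneric (-K) q p)
    (hGb : ThetaGeneric b q p) (hGb' : ThetaGeneric (-b) q p)
    (hGKb : ThetaGeneric (K * q / b) (q ^ 2) (p ^ 2))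
    (hGbK : ThetaGeneric (b * q / K) (q ^ 2) (p ^ 2)) {j k : ℕ} (hk : k ≤ j)
    (hqj : thetaPoch (q ^ 2) (q ^ 2) (p ^ 2) j ≠ 0) :
    ∑ i ∈ Finset.Ico k (j + 1), baileyL (b * K * q) (K ^ 2) (q ^ 2) (p ^ 2) j i
        * (theta (-K) p / theta (-K * q ^ (2 * i)) p * q⁻¹ ^ i) * baileyM b K q p i k
      = theta (b * K * q * (q ^ 2) ^ (2 * j)) (p ^ 2) / theta (b * K * q) (p ^ 2)
        * (thetaPoch (-b * q) q p (2 * j) / thetaPoch (-K * q) q p (2 * j)) * q⁻¹ ^ j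
        * baileyM (b ^ 2) (b * K * q) (q ^ 2) (p ^ 2) j k := by
  obtain ⟨N, rfl⟩ := Nat.exists_eq_add_of_le hk
  have hz : q ^ (2 * k) ≠ 0 := pow_ne_zero _ hq
  have key := sum_quadratic hp hp0 (κ := K * q ^ (2 * k)) (b := b * q ^ (2 * k)) (N := N)
    (by positivity) (by positivity) hq (hGK.mul_pow hq _)
    (by rw [← neg_mul]; exact hGK'.mul_pow hq _) (hGb.mul_pow hq _)
    (by rw [← neg_mul]; exact hGb'.mul_pow hq _)
    (by rwa [show K * q ^ (2 * k) * q / (b * q ^ (2 * k)) = K * q / b by field_simp])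
    (by rwa [show b * q ^ (2 * k) * q / (K * q ^ (2 * k)) = b * q / K by field_simp])
    (thetaPoch_ne_zero_of_le (Nat.le_add_left N k) hqj)
  rw [Finset.sum_Ico_eq_sum_range, show k + N + 1 - k = N + 1 by omega]
  have hterm : ∀ m ∈ Finset.range (N + 1),
      baileyL (b * K * q) (K ^ 2) (q ^ 2) (p ^ 2) (k + N) (k + m)
        * (theta (-K) p / theta (-K * q ^ (2 * (k + m))) p * q⁻¹ ^ (k + m))
        * baileyM b K q p (k + m) k
      = theta (b * K * q * (q ^ 2) ^ (2 * (k + N))) (p ^ 2) / theta (b * K * q) (p ^ 2)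
        / theta (K ^ 2) (p ^ 2) * (thetaPoch (b * K * q) (q ^ 2) (p ^ 2) (2 * k)
          / thetaPoch (K ^ 2 * q ^ 2) (q ^ 2) (p ^ 2) (2 * k)) * theta (-K) p * q⁻¹ ^ k
        * (thetaPoch K q p (2 * k) / thetaPoch (b * q) q p (2 * k))
        * (theta ((K * q ^ (2 * k)) ^ 2 * q ^ (4 * m)) (p ^ 2)
            / theta (-(K * q ^ (2 * k)) * q ^ (2 * m)) p
          * (q⁻¹ ^ m * (K * q ^ (2 * k) / (b * q ^ (2 * k) * q)) ^ (N - m))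
          * (thetaPoch (K * q ^ (2 * k)) q p m * thetaPoch (K * q ^ (2 * k) / (b * q ^ (2 * k))) q p m
            / (thetaPoch q q p m * thetaPoch (b * q ^ (2 * k) * q) q p m))
          * (thetaPoch (b * q ^ (2 * k) * (K * q ^ (2 * k)) * q) (q ^ 2) (p ^ 2) (N + m)
              * thetaPoch (b * q ^ (2 * k) * q / (K * q ^ (2 * k))) (q ^ 2) (p ^ 2) (N - m)
            / (thetaPoch ((K * q ^ (2 * k)) ^ 2 * q ^ 2) (q ^ 2) (p ^ 2) (N + m)
              * thetaPoch (q ^ 2) (q ^ 2) (p ^ 2) (N - m)))) := by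
    intro m _
    simp only [baileyL, baileyM]
    rw [show k + N + (k + m) = 2 * k + (N + m) by omega, show k + N - (k + m) = N - m by omega,
      show k + m - k = m by omega, show k + m + k = 2 * k + m by omega,
      thetaPoch_add (b * K * q), thetaPoch_add (K ^ 2 * q ^ 2), thetaPoch_add K,
      thetaPoch_add (b * q),
      show b * q ^ (2 * k) * q / (K * q ^ (2 * k)) = b * K * q / K ^ 2 by field_simp,
      show K * q ^ (2 * k) / (b * q ^ (2 * k)) = K / b by field_simp,
      show K * q ^ (2 * k) / (b * q ^ (2 * k) * q) = K ^ 2 / (b * K * q) by field_simp,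
      show b * K * q * (q ^ 2) ^ (2 * k) = b * q ^ (2 * k) * (K * q ^ (2 * k)) * q by ring,
      show K ^ 2 * q ^ 2 * (q ^ 2) ^ (2 * k) = (K * q ^ (2 * k)) ^ 2 * q ^ 2 by ring,
      show b * q * q ^ (2 * k) = b * q ^ (2 * k) * q by ring,
      show K ^ 2 * (q ^ 2) ^ (2 * (k + m)) = (K * q ^ (2 * k)) ^ 2 * q ^ (4 * m) by ring,
      show -K * q ^ (2 * (k + m)) = -(K * q ^ (2 * k)) * q ^ (2 * m) by ring,
      pow_add q⁻¹ k m]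
    ring
  rw [Finset.sum_congr rfl hterm, ← Finset.mul_sum, key]
  have e1 : thetaPoch K q p (2 * k) * (theta (K * q ^ (2 * k)) p
      * thetaPoch (K * q ^ (2 * k) * q) q p N) = theta K p * thetaPoch (K * q) q p (2 * k + N) := by
    rw [← thetaPoch_succ', ← thetaPoch_add, ← add_assoc, thetaPoch_succ']
  simp only [baileyM]
  rw [show k + N - k = N by omega, show k + N + k = 2 * k + N by omega,
    show 2 * (k + N) = 2 * k + N + N by omega,
    thetaPoch_add (-b * q), thetaPoch_add (-K * q),
    show b ^ 2 * q ^ 2 = (b * q) ^ 2 by ring, thetaPoch_sq hp (x := b * q),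
    show b * K * q / b ^ 2 = K * q / b by field_simp,
    show K * q ^ (2 * k) * q / (b * q ^ (2 * k)) = K * q / b by field_simp,
    show -(b * q ^ (2 * k)) * q ^ (N + 1) = -b * q * q ^ (2 * k + N) by ring,
    show -(K * q ^ (2 * k)) * q ^ (N + 1) = -K * q * q ^ (2 * k + N) by ring,
    theta_sq hp (x := K)]
  have e2 := thetaPoch_sq hp (x := K * q) (q := q) (2 * k + N)
  rw [mul_pow, thetaPoch_add (K ^ 2 * q ^ 2),
    show K ^ 2 * q ^ 2 * (q ^ 2) ^ (2 * k) = (K * q ^ (2 * k)) ^ 2 * q ^ 2 by ring] at e2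
  have e3 := thetaPoch_add (b * K * q) (q ^ 2) (p ^ 2) (2 * k) N
  rw [show b * K * q * (q ^ 2) ^ (2 * k) = b * q ^ (2 * k) * (K * q ^ (2 * k)) * q by ring] at e3
  have e4 := thetaPoch_add (b * q) q p (2 * k) N
  rw [show b * q * q ^ (2 * k) = b * q ^ (2 * k) * q by ring] at e4
  rw [e3, e4, pow_add q⁻¹, neg_mul b, neg_mul K]
  have n1 := hGK.theta_ne_zero
  have n2 := hGK'.theta_ne_zero
  have n3 := (hGK.mul hq).thetaPoch_ne_zero (2 * k + N)
  have n4 : thetaPoch (-(K * q)) q p (2 * k + N) ≠ 0 := by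
    rw [← neg_mul]; exact (hGK'.mul hq).thetaPoch_ne_zero _
  have n5 : thetaPoch (-(b * q)) q p (2 * k + N) ≠ 0 := by
    rw [← neg_mul]; exact (hGb'.mul hq).thetaPoch_ne_zero _
  generalize thetaPoch (-(b * q)) q p (2 * k + N) = x1 at *
  generalize thetaPoch (-(K * q)) q p (2 * k + N) = x2 at *
  generalize thetaPoch (K * q) q p (2 * k + N) = x3 at *
  generalize theta (-K) p = x4 at *
  generalize theta K p = x5 at *
  generalize thetaPoch (K ^ 2 * q ^ 2) (q ^ 2) (p ^ 2) (2 * k) = x6 at *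
  generalize thetaPoch ((K * q ^ (2 * k)) ^ 2 * q ^ 2) (q ^ 2) (p ^ 2) N = x7 at *
  generalize thetaPoch K q p (2 * k) = x8 at *
  generalize theta (K * q ^ (2 * k)) p = x9 at *
  generalize thetaPoch (K * q ^ (2 * k) * q) q p N = x10 at *
  generalize thetaPoch (b * K * q) (q ^ 2) (p ^ 2) (2 * k) = x11 at *
  generalize thetaPoch (b * q ^ (2 * k) * (K * q ^ (2 * k)) * q) (q ^ 2) (p ^ 2) N = x12 at *
  generalize thetaPoch (b * q) q p (2 * k) = x13 at *
  generalize thetaPoch (b * q ^ (2 * k) * q) q p N = x14 at *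
  generalize thetaPoch (-(b * q) * q ^ (2 * k + N)) q p N = x15 at *
  generalize thetaPoch (-(K * q) * q ^ (2 * k + N)) q p N = x16 at *
  generalize theta (b * K * q * (q ^ 2) ^ (2 * k + N + N)) (p ^ 2) / theta (b * K * q) (p ^ 2) = x17
  generalize thetaPoch (K * q / b) (q ^ 2) (p ^ 2) N = x18
  generalize thetaPoch (q ^ 2) (q ^ 2) (p ^ 2) N = x19
  trans x17 * (x4 * x4⁻¹) * (x11 * x12) * (q⁻¹ ^ k * q⁻¹ ^ N) * (x8 * (x9 * x10))
    / (x5 * (x6 * x7) * (x13 * x14) * x19) * x18 * (x15 / x16)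
  · ring
  trans x17 * (x1 * x1⁻¹) * (x11 * x12) * (q⁻¹ ^ k * q⁻¹ ^ N) / (x2 * (x13 * x14) * x19) * x18
    * (x15 / x16)
  · rw [e1, e2, mul_inv_cancel₀ n2, mul_inv_cancel₀ n5]
    trans x17 * (x11 * x12) * (q⁻¹ ^ k * q⁻¹ ^ N) / (x2 * (x13 * x14) * x19) * x18
      * (x15 / x16) * (x5 * x5⁻¹) * (x3 * x3⁻¹)
    · ring
    · rw [mul_inv_cancel₀ n1, mul_inv_cancel₀ n3]
      ring
  · ring

/-- The fourth power of `z` does not lie in the group generated by `q` and `p`. Then the same holds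
for `±z`, for `z²`, and for their inverses. -/
def PowFourGeneric (z q p : ℂ) : Prop := ∀ i j : ℤ, z ^ 4 ≠ q ^ i * p ^ j

/-- The exponent `n` is chosen among divisors of `4` and their negatives in the applications, so that
`x` is, up to a factor from the group generated by `q` and `p`, one of `±z`, `z²` or an inverse. -/
theorem PowFourGeneric.thetaGeneric {z x q p : ℂ} (h : PowFourGeneric z q p) (hp : ‖p‖ < 1)
    (hp0 : p ≠ 0) (hq : q ≠ 0) (m : ℕ) {l : ℕ} (hl : l ≠ 0) (n r t : ℤ)
    (hx : x ^ n = z ^ 4 * (q ^ r * p ^ t)) : ThetaGeneric x (q ^ m) (p ^ l) := by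
  intro i
  refine theta_ne_zero (by rw [norm_pow]; exact pow_lt_one₀ (norm_nonneg p) hp hl)
    (pow_ne_zero l hp0) fun k hk => h (-(m * i * n) - r) (l * k * n - t) ?_
  have h1 : x = q ^ (-((m : ℤ) * i)) * p ^ ((l : ℤ) * k) := by
    rw [← zpow_natCast q, ← zpow_mul, ← zpow_natCast p, ← zpow_mul] at hk
    rw [← hk, zpow_neg]
    field_simp
  rw [h1, mul_zpow, ← zpow_mul, ← zpow_mul, neg_mul] at hx
  rw [zpow_sub₀ hq, zpow_sub₀ hp0, div_mul_div_comm, hx]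
  field_simp

/-- The summand on the left, without the Bailey matrix. -/
noncomputable def leftSeq (b K q p : ℂ) (j : ℕ) : ℂ :=
  theta (b * K * q * (q ^ 2) ^ (2 * j)) (p ^ 2) / theta (b * K * q) (p ^ 2)
    * (thetaPoch (-b * q) q p (2 * j) / thetaPoch (-K * q) q p (2 * j)) * q⁻¹ ^ j
    * (thetaPoch (b * K * q) (q ^ 2) (p ^ 2) j * thetaPoch (b * K * q / K ^ 2) (q ^ 2) (p ^ 2) j
      / (thetaPoch (q ^ 2) (q ^ 2) (p ^ 2) j * thetaPoch (K ^ 2 * q ^ 2) (q ^ 2) (p ^ 2) j)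
      * (thetaPoch (K ^ 2 * q ^ 2) (q ^ 2) ((p ^ 2) ^ 2) (2 * j)
        / thetaPoch (b ^ 2 * q ^ 2) (q ^ 2) ((p ^ 2) ^ 2) (2 * j)))

/-- The summand on the right, without the Bailey matrix. -/
noncomputable def rightSeq (b K q p : ℂ) (k : ℕ) : ℂ :=
  theta (b ^ 2 * p ^ 2 * (q ^ 2) ^ (2 * k)) ((p ^ 2) ^ 2) / theta (b ^ 2 * p ^ 2) ((p ^ 2) ^ 2)
    * (thetaPoch (b ^ 2 * p ^ 2) (q ^ 2) ((p ^ 2) ^ 2) k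
        * thetaPoch (b ^ 2 / K ^ 2) (q ^ 2) ((p ^ 2) ^ 2) k
      / (thetaPoch (q ^ 2) (q ^ 2) ((p ^ 2) ^ 2) k
        * thetaPoch (K ^ 2 * p ^ 2 * q ^ 2) (q ^ 2) ((p ^ 2) ^ 2) k)) * (b * K * q / b ^ 2) ^ k

/-- The transformation in terms of Bailey matrices: the left-hand side inverts the Bailey matrix
relative to `(bKq, K²)`, and `sum_baileyL_mul_baileyM` and `sum_baileyM_mul_unit` compute the
coefficients of the inversion. -/
theorem sum_baileyM_mul_leftSeq {b K q p : ℂ} (hp : ‖p‖ < 1) (hp0 : p ≠ 0) (hb : b ≠ 0)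
    (hK : K ≠ 0) (hq : q ≠ 0) (h1 : PowFourGeneric (b * K) q p) (h2 : PowFourGeneric K q p)
    (h3 : PowFourGeneric (b * K ^ 3) q p) (h4 : PowFourGeneric (b / K) q p)
    (h5 : PowFourGeneric b q p) {n : ℕ} (hqn : thetaPoch (q ^ 2) (q ^ 2) (p ^ 2) n ≠ 0) :
    ∑ j ∈ Finset.range (n + 1), baileyM (b * K * q) (K ^ 2) (q ^ 2) (p ^ 2) n j * leftSeq b K q p j
      = theta (-K) p / theta (-K * q ^ (2 * n)) p * q⁻¹ ^ n
        * ∑ k ∈ Finset.range (n + 1), baileyM b K q p n k * rightSeq b K q p k := by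
  have hp2 := norm_sq_lt_one hp
  have hp20 : p ^ 2 ≠ 0 := pow_ne_zero 2 hp0
  have hq2 : q ^ 2 ≠ 0 := pow_ne_zero 2 hq
  -- genericity in base `q` and nome `p`
  have g1 : ∀ {z x : ℂ}, PowFourGeneric z q p → ∀ (r t : ℤ), x ^ (4 : ℤ) = z ^ 4 * (q ^ r * p ^ t) →
      ThetaGeneric x q p := fun hz r t hx => by
    simpa using hz.thetaGeneric hp hp0 hq 1 one_ne_zero 4 r t hx
  -- genericity in base `q²` and nome `p²`
  have g2 : ∀ {z x : ℂ}, PowFourGeneric z q p → ∀ (n r t : ℤ), x ^ n = z ^ 4 * (q ^ r * p ^ t) →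
      ThetaGeneric x (q ^ 2) (p ^ 2) := fun hz n r t hx =>
    hz.thetaGeneric hp hp0 hq 2 two_ne_zero n r t hx
  -- genericity in base `q²` and nome `p⁴`
  have g4 : ∀ {z x : ℂ}, PowFourGeneric z q p → ∀ (n r t : ℤ), x ^ n = z ^ 4 * (q ^ r * p ^ t) →
      ThetaGeneric x (q ^ 2) ((p ^ 2) ^ 2) := fun hz n r t hx => by
    rw [← pow_mul]; exact hz.thetaGeneric hp hp0 hq 2 four_ne_zero n r t hx
  have hα : ∀ j ∈ Finset.range (n + 1), leftSeq b K q p j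
      = ∑ i ∈ Finset.range (j + 1), ∑ k ∈ Finset.range (i + 1),
        baileyL (b * K * q) (K ^ 2) (q ^ 2) (p ^ 2) j i
          * (theta (-K) p / theta (-K * q ^ (2 * i)) p * q⁻¹ ^ i) * baileyM b K q p i k
          * rightSeq b K q p k := by
    intro j hj
    have hqj := thetaPoch_ne_zero_of_le (Nat.lt_succ_iff.1 (Finset.mem_range.1 hj)) hqn
    have ho := sum_baileyM_mul_unit hp2 hp20 (B := b ^ 2) (k := K ^ 2) (a := b * K * q) (Q := q ^ 2)
      (by positivity) (by positivity) (by positivity) hq2 (by ring)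
      (g4 h5 2 0 0 (by push_cast [zpow_ofNat]; ring))
      (g4 h5 2 0 4 (by push_cast [zpow_ofNat]; ring))
      (g4 h2 2 0 4 (by push_cast [zpow_ofNat]; ring))
      (g4 h4 4 (-4) 8 (by rw [zpow_neg]; push_cast [zpow_ofNat]; field_simp))
      (g4 h4 4 4 0 (by push_cast [zpow_ofNat]; field_simp))
      (g4 h2 2 0 0 (by push_cast [zpow_ofNat]; ring))
      (g2 h4 (-4) (-4) 0 (by rw [zpow_neg, zpow_neg]; push_cast [zpow_ofNat]; field_simp)) hqj
    rw [leftSeq, ← ho, Finset.mul_sum, Finset.sum_comm' (t' := Finset.range (j + 1))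
      (s' := fun k => Finset.Ico k (j + 1)) (by intro x y; simp; omega)]
    refine Finset.sum_congr rfl fun k hk => ?_
    rw [← Finset.sum_mul, sum_baileyL_mul_baileyM hp hp0 hb hK hq
      (g1 h2 0 0 (by push_cast [zpow_ofNat]; ring)) (g1 h2 0 0 (by push_cast [zpow_ofNat]; ring))
      (g1 h5 0 0 (by push_cast [zpow_ofNat]; ring)) (g1 h5 0 0 (by push_cast [zpow_ofNat]; ring))
      (g2 h4 (-4) (-4) 0 (by rw [zpow_neg, zpow_neg]; push_cast [zpow_ofNat]; field_simp))
      (g2 h4 4 4 0 (by push_cast [zpow_ofNat]; field_simp))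
      (Nat.lt_succ_iff.1 (Finset.mem_range.1 hk)) hqj, rightSeq]
    ring
  rw [Finset.sum_congr rfl fun j hj => by rw [hα j hj, Finset.mul_sum],
    Finset.sum_comm' (t' := Finset.range (n + 1)) (s' := fun i => Finset.Ico i (n + 1))
      (by intro x y; simp; omega)]
  have hinv : ∀ i ∈ Finset.range (n + 1), ∑ j ∈ Finset.Ico i (n + 1),
      baileyM (b * K * q) (K ^ 2) (q ^ 2) (p ^ 2) n j * ∑ k ∈ Finset.range (i + 1),
        baileyL (b * K * q) (K ^ 2) (q ^ 2) (p ^ 2) j i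
          * (theta (-K) p / theta (-K * q ^ (2 * i)) p * q⁻¹ ^ i) * baileyM b K q p i k
          * rightSeq b K q p k
      = (if i = n then 1 else 0) * (theta (-K) p / theta (-K * q ^ (2 * i)) p * q⁻¹ ^ i
        * ∑ k ∈ Finset.range (i + 1), baileyM b K q p i k * rightSeq b K q p k) := by
    intro i hi
    rw [← sum_baileyM_mul_baileyL hp2 hp20 (a := b * K * q) (k := K ^ 2) (by positivity)
      (by positivity) hq2 (g2 h1 4 4 0 (by push_cast [zpow_ofNat]; ring))
      (g2 h2 2 0 0 (by push_cast [zpow_ofNat]; ring))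
      (g2 h3 4 4 0 (by push_cast [zpow_ofNat]; ring))
      (g2 h4 4 4 0 (by push_cast [zpow_ofNat]; field_simp))
      (Nat.lt_succ_iff.1 (Finset.mem_range.1 hi)) hqn, Finset.sum_mul]
    refine Finset.sum_congr rfl fun j _ => ?_
    rw [Finset.mul_sum, Finset.mul_sum, Finset.mul_sum]
    refine Finset.sum_congr rfl fun k _ => ?_
    ring
  rw [Finset.sum_congr rfl hinv]
  simp

/-! ### The transformation in explicit form -/

/-- The left-hand side of the transformation. -/
noncomputable def leftSide (n : ℕ) (q a b p : ℂ) : ℂ :=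
  ∑ j ∈ Finset.range (n + 1),
      (theta (a * q ^ (4 * j)) (p ^ 2)
          * (thetaPoch a (q ^ 2) (p ^ 2) j
            * thetaPoch (a ^ 2 * q ^ (2 * (n : ℤ) - 2) / b ^ 2) (q ^ 2) (p ^ 2) j
            * thetaPoch (q ^ (-2 * (n : ℤ))) (q ^ 2) (p ^ 2) j
            * thetaPoch (b ^ 2 * q ^ 2 / a) (q ^ 2) (p ^ 2) j)
          * thetaPoch (a ^ 2 / b ^ 2) (q ^ 2) (p ^ 4) (2 * j)
          * thetaPoch (-b * q) q p (2 * j))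
        / (theta a (p ^ 2)
          * (thetaPoch (q ^ 2) (q ^ 2) (p ^ 2) j
            * thetaPoch (b ^ 2 * q ^ (4 - 2 * (n : ℤ)) / a) (q ^ 2) (p ^ 2) j
            * thetaPoch (a * q ^ (2 * n + 2)) (q ^ 2) (p ^ 2) j
            * thetaPoch (a ^ 2 / b ^ 2) (q ^ 2) (p ^ 2) j)
          * thetaPoch (b ^ 2 * q ^ 2) (q ^ 2) (p ^ 4) (2 * j)
          * thetaPoch (-a / b) q p (2 * j))
        * (b ^ 2 * q ^ 3 / a) ^ j

/-- The factor in front of the sum on the right-hand side of the transformation. -/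
noncomputable def rightFactor (n : ℕ) (q a b p : ℂ) : ℂ :=
  (theta (-a / (b * q)) p
          * (thetaPoch (-q) q p n * thetaPoch (a / (b ^ 2 * q)) q p n)
          * thetaPoch (a * q ^ 2) (q ^ 2) (p ^ 2) n)
        / (theta (-a * q ^ (2 * (n : ℤ) - 1) / b) p
          * (thetaPoch (-a / (b * q)) q p n * thetaPoch (b * q) q p n)
          * thetaPoch (a / (b ^ 2 * q ^ 2)) (q ^ 2) (p ^ 2) n)
        * q ^ (-(n : ℤ))

/-- The sum on the right-hand side of the transformation. -/
noncomputable def rightSum (n : ℕ) (q a b p : ℂ) : ℂ :=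
  ∑ k ∈ Finset.range (n + 1),
          (theta (b ^ 2 * q ^ (4 * k) * p ^ 2) (p ^ 4)
              * (thetaPoch (a * q ^ ((n : ℤ) - 1) / b) q p k
                * thetaPoch (q ^ (-(n : ℤ))) q p k)
              * (thetaPoch (b ^ 2 * p ^ 2) (q ^ 2) (p ^ 4) k
                * thetaPoch (b ^ 4 * q ^ 2 / a ^ 2) (q ^ 2) (p ^ 4) k))
            / (theta (b ^ 2 * p ^ 2) (p ^ 4)
              * (thetaPoch (b ^ 2 * q ^ (2 - (n : ℤ)) / a) q p k
                * thetaPoch (b * q ^ (n + 1)) q p k)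
              * (thetaPoch (q ^ 2) (q ^ 2) (p ^ 4) k
                * thetaPoch (a ^ 2 * p ^ 2 / b ^ 2) (q ^ 2) (p ^ 4) k))
            * q ^ (2 * k)

theorem leftSide_eq_rightFactor_mul_rightSum_of_generic {b K q p : ℂ} (hp : ‖p‖ < 1) (hp0 : p ≠ 0)
    (hb : b ≠ 0) (hK : K ≠ 0) (hq : q ≠ 0) (h1 : PowFourGeneric (b * K) q p)
    (h2 : PowFourGeneric K q p) (h3 : PowFourGeneric (b * K ^ 3) q p)
    (h4 : PowFourGeneric (b / K) q p) (h5 : PowFourGeneric b q p) {n : ℕ}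
    (hqn : thetaPoch (q ^ 2) (q ^ 2) (p ^ 2) n ≠ 0) :
    leftSide n q (b * K * q) b p
      = rightFactor n q (b * K * q) b p * rightSum n q (b * K * q) b p := by
  have hp2 := norm_sq_lt_one hp
  have hq2 : q ^ 2 ≠ 0 := pow_ne_zero 2 hq
  have main := sum_baileyM_mul_leftSeq hp hp0 hb hK hq h1 h2 h3 h4 h5 hqn
  have hqn1 : thetaPoch q q p n ≠ 0 ∧ thetaPoch (-q) q p n ≠ 0 := by
    rw [thetaPoch_sq hp, mul_ne_zero_iff] at hqn
    exact hqn
  have ga : ThetaGeneric (b * K * q) (q ^ 2) (p ^ 2) :=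
    h1.thetaGeneric hp hp0 hq 2 two_ne_zero 4 4 0 (by push_cast [zpow_ofNat]; ring)
  have gK2 : ThetaGeneric (K ^ 2) (q ^ 2) (p ^ 2) :=
    h2.thetaGeneric hp hp0 hq 2 two_ne_zero 2 0 0 (by push_cast [zpow_ofNat]; ring)
  have gKa : ThetaGeneric (K ^ 2 / (b * K * q)) (q ^ 2) (p ^ 2) :=
    h4.thetaGeneric hp hp0 hq 2 two_ne_zero (-4) 4 0
      (by rw [zpow_neg]; push_cast [zpow_ofNat]; field_simp)
  have gK : ThetaGeneric K q p := by
    simpa using h2.thetaGeneric (x := K) hp hp0 hq 1 one_ne_zero 4 0 0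
      (by push_cast [zpow_ofNat]; ring)
  have gK' : ThetaGeneric (-K) q p := by
    simpa using h2.thetaGeneric (x := -K) hp hp0 hq 1 one_ne_zero 4 0 0
      (by push_cast [zpow_ofNat]; ring)
  have gb : ThetaGeneric b q p := by
    simpa using h5.thetaGeneric (x := b) hp hp0 hq 1 one_ne_zero 4 0 0
      (by push_cast [zpow_ofNat]; ring)
  have gKb : ThetaGeneric (K / b) q p := by
    simpa using h4.thetaGeneric (x := K / b) hp hp0 hq 1 one_ne_zero (-4) 0 0
      (by rw [zpow_neg]; push_cast [zpow_ofNat]; field_simp)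
  have hM : baileyM (b * K * q) (K ^ 2) (q ^ 2) (p ^ 2) n 0 ≠ 0 :=
    div_ne_zero (mul_ne_zero (gKa.thetaPoch_ne_zero n) (gK2.thetaPoch_ne_zero n))
      (mul_ne_zero hqn ((ga.mul hq2).thetaPoch_ne_zero n))
  have z1 : q ^ (2 * (n : ℤ)) = q ^ (2 * n) := by exact_mod_cast zpow_natCast q (2 * n)
  have hqn2 : q ^ n ≠ 0 := pow_ne_zero n hq
  have hqn3 : q ^ (2 * n) ≠ 0 := pow_ne_zero _ hq
  have hleft : baileyM (b * K * q) (K ^ 2) (q ^ 2) (p ^ 2) n 0 * leftSide n q (b * K * q) b p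
      = ∑ j ∈ Finset.range (n + 1),
        baileyM (b * K * q) (K ^ 2) (q ^ 2) (p ^ 2) n j * leftSeq b K q p j := by
    rw [leftSide, Finset.mul_sum]
    refine Finset.sum_congr rfl fun j hj => ?_
    rw [baileyM_eq hp2 (by positivity) (by positivity) hq2
      (Nat.lt_succ_iff.1 (Finset.mem_range.1 hj)) (gKa.thetaPoch_ne_zero n) hqn, leftSeq,
      show b * K * q * q ^ (4 * j) = b * K * q * (q ^ 2) ^ (2 * j) by ring,
      show (b * K * q) ^ 2 * q ^ (2 * (n : ℤ) - 2) / b ^ 2 = K ^ 2 * (q ^ 2) ^ n by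
        rw [zpow_sub₀ hq, z1, ← pow_mul]; push_cast [zpow_ofNat]; field_simp,
      show q ^ (-2 * (n : ℤ)) = q ^ 2 / (q ^ 2) ^ (n + 1) by
        rw [neg_mul, zpow_neg, z1, ← pow_mul, mul_add, pow_add]; field_simp,
      show b ^ 2 * q ^ 2 / (b * K * q) = b * K * q / K ^ 2 by field_simp,
      show b ^ 2 * q ^ (4 - 2 * (n : ℤ)) / (b * K * q)
          = q ^ 2 * (b * K * q) / (K ^ 2 * (q ^ 2) ^ n) by
        rw [zpow_sub₀ hq, z1, ← pow_mul]; push_cast [zpow_ofNat]; field_simp,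
      show b * K * q * q ^ (2 * n + 2) = b * K * q * (q ^ 2) ^ (n + 1) by ring,
      show (b * K * q) ^ 2 / b ^ 2 = K ^ 2 * q ^ 2 by field_simp,
      show -(b * K * q) / b = -K * q by field_simp,
      show b ^ 2 * q ^ 3 / (b * K * q) = q ^ 2 * (b * K * q) / K ^ 2 * q⁻¹ by field_simp,
      mul_pow _ q⁻¹ j, show p ^ 4 = (p ^ 2) ^ 2 by ring]
    ring
  have hright : baileyM b K q p n 0 * rightSum n q (b * K * q) b p
      = ∑ k ∈ Finset.range (n + 1), baileyM b K q p n k * rightSeq b K q p k := by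
    rw [rightSum, Finset.mul_sum]
    refine Finset.sum_congr rfl fun k hk => ?_
    rw [baileyM_eq hp hb hK hq (Nat.lt_succ_iff.1 (Finset.mem_range.1 hk))
      (gKb.thetaPoch_ne_zero n) hqn1.1, rightSeq,
      show b ^ 2 * q ^ (4 * k) * p ^ 2 = b ^ 2 * p ^ 2 * (q ^ 2) ^ (2 * k) by ring,
      show b * K * q * q ^ ((n : ℤ) - 1) / b = K * q ^ n by
        rw [zpow_sub₀ hq, zpow_natCast, zpow_one]; field_simp,
      show q ^ (-(n : ℤ)) = q / q ^ (n + 1) by rw [zpow_neg, zpow_natCast, pow_succ]; field_simp,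
      show b ^ 4 * q ^ 2 / (b * K * q) ^ 2 = b ^ 2 / K ^ 2 by field_simp,
      show b ^ 2 * q ^ (2 - (n : ℤ)) / (b * K * q) = q * b / (K * q ^ n) by
        rw [zpow_sub₀ hq, zpow_natCast]; push_cast [zpow_ofNat]; field_simp,
      show (b * K * q) ^ 2 * p ^ 2 / b ^ 2 = K ^ 2 * p ^ 2 * q ^ 2 by field_simp,
      show p ^ 4 = (p ^ 2) ^ 2 by ring,
      show q ^ (2 * k) = (q * b / K) ^ k * (b * K * q / b ^ 2) ^ k by
        rw [← mul_pow, pow_mul]; congr 1; field_simp]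
    ring
  have hfactor : baileyM (b * K * q) (K ^ 2) (q ^ 2) (p ^ 2) n 0 * rightFactor n q (b * K * q) b p
      = theta (-K) p / theta (-K * q ^ (2 * n)) p * q⁻¹ ^ n * baileyM b K q p n 0 := by
    have n1 := gKa.thetaPoch_ne_zero n
    have n2 := (ga.mul hq2).thetaPoch_ne_zero n
    have n3 := gK'.thetaPoch_ne_zero n
    have n4 := hqn1.2
    simp only [baileyM, rightFactor, Nat.sub_zero, Nat.add_zero]
    rw [thetaPoch_sq hp (x := K), thetaPoch_sq hp (x := q),
      show -(b * K * q) / (b * q) = -K by field_simp,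
      show b * K * q / (b ^ 2 * q) = K / b by field_simp,
      show -(b * K * q) * q ^ (2 * (n : ℤ) - 1) / b = -K * q ^ (2 * n) by
        rw [zpow_sub₀ hq, z1, zpow_one]; field_simp,
      show b * K * q / (b ^ 2 * q ^ 2) = K ^ 2 / (b * K * q) by field_simp,
      zpow_neg, zpow_natCast, inv_pow]
    generalize thetaPoch (K ^ 2 / (b * K * q)) (q ^ 2) (p ^ 2) n = x1 at *
    generalize thetaPoch (b * K * q * q ^ 2) (q ^ 2) (p ^ 2) n = x2 at *
    generalize thetaPoch (-K) q p n = x3 at *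
    generalize thetaPoch (-q) q p n = x4 at *
    trans theta (-K) p / theta (-K * q ^ (2 * n)) p * (q ^ n)⁻¹ *
      (thetaPoch (K / b) q p n * thetaPoch K q p n / (thetaPoch q q p n * thetaPoch (b * q) q p n))
      * (x1 * x1⁻¹) * (x2 * x2⁻¹) * (x3 * x3⁻¹) * (x4 * x4⁻¹)
    · ring
    · rw [mul_inv_cancel₀ n1, mul_inv_cancel₀ n2, mul_inv_cancel₀ n3, mul_inv_cancel₀ n4]
      ring
  refine mul_left_cancel₀ hM ?_
  rw [hleft, main, ← mul_assoc, hfactor, ← hright]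
  ring

/-! ### Extension to all parameters by continuity -/

theorem continuousAt_theta {X : Type*} [TopologicalSpace X] {f g : X → ℂ} {v : X}
    (hf : ContinuousAt f v) (hg : ContinuousAt g v) (hgv : ‖g v‖ < 1) (hfv : f v ≠ 0) :
    ContinuousAt (fun w => theta (f w) (g w)) v :=
  tendsto_theta hgv hfv hf hg

/-- In `θ(x p²; p⁴)` the nome may tend to `0`, although the argument then tends to `0` as well. -/
theorem continuousAt_theta_mul_sq {X : Type*} [TopologicalSpace X] {f g : X → ℂ} {v : X}
    (hf : ContinuousAt f v) (hg : ContinuousAt g v) (hgv : ‖g v‖ < 1) (hfv : f v ≠ 0) :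
    ContinuousAt (fun w => theta (f w * g w ^ 2) (g w ^ 4)) v := by
  have e : ∀ c p : ℂ, theta (c * p ^ 2) (p ^ 4)
      = qPochInf (c * p ^ 2) (p ^ 4) * qPochInf (p ^ 2 / c) (p ^ 4) := by
    intro c p
    rw [theta]
    congr 2
    rcases eq_or_ne p 0 with rfl | hp
    · simp
    · rw [show p ^ 4 = p ^ 2 * p ^ 2 by ring, mul_div_mul_right _ _ (pow_ne_zero 2 hp)]
  simp only [e]
  have h4 : ‖g v ^ 4‖ < 1 := by
    rw [norm_pow]; exact pow_lt_one₀ (norm_nonneg _) hgv four_ne_zero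
  have c1 : ContinuousAt (fun w => qPochInf (f w * g w ^ 2) (g w ^ 4)) v :=
    tendsto_qPochInf h4 (hf.mul (hg.pow 2)) (hg.pow 4)
  have c2 : ContinuousAt (fun w => qPochInf (g w ^ 2 / f w) (g w ^ 4)) v :=
    tendsto_qPochInf h4 ((hg.pow 2).div hf hfv) (hg.pow 4)
  exact c1.mul c2

theorem continuousAt_thetaPoch {X : Type*} [TopologicalSpace X] {f g : X → ℂ} {v : X} {q : ℂ}
    (hq : q ≠ 0) (hf : ContinuousAt f v) (hg : ContinuousAt g v) (hgv : ‖g v‖ < 1) (hfv : f v ≠ 0)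
    (k : ℕ) : ContinuousAt (fun w => thetaPoch (f w) q (g w) k) v := by
  simp only [thetaPoch]
  exact tendsto_finsetProd _ fun i _ => continuousAt_theta (hf.mul_const _) hg hgv
    (mul_ne_zero hfv (pow_ne_zero i hq))

theorem continuousAt_thetaPoch_mul_sq {X : Type*} [TopologicalSpace X] {f g : X → ℂ} {v : X}
    {q : ℂ} (hq : q ≠ 0) (hf : ContinuousAt f v) (hg : ContinuousAt g v) (hgv : ‖g v‖ < 1)
    (hfv : f v ≠ 0) (k : ℕ) :
    ContinuousAt (fun w => thetaPoch (f w * g w ^ 2) q (g w ^ 4) k) v := by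
  simp only [thetaPoch, mul_right_comm (f _)]
  exact tendsto_finsetProd _ fun i _ => continuousAt_theta_mul_sq (hf.mul_const _) hg hgv
    (mul_ne_zero hfv (pow_ne_zero i hq))

/-- The parameters `(a, b, p)` for which `leftSide_eq_rightFactor_mul_rightSum_of_generic` applies
with `K = a / (bq)`. -/
def genericParameters (q : ℂ) : Set (ℂ × ℂ × ℂ) :=
  {v | v.2.2 ≠ 0 ∧ v.1 ≠ 0 ∧ v.2.1 ≠ 0 ∧ ∃ K : ℂ, v.1 = v.2.1 * K * q
    ∧ PowFourGeneric (v.2.1 * K) q v.2.2 ∧ PowFourGeneric K q v.2.2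
    ∧ PowFourGeneric (v.2.1 * K ^ 3) q v.2.2 ∧ PowFourGeneric (v.2.1 / K) q v.2.2
    ∧ PowFourGeneric v.2.1 q v.2.2}

theorem mem_closure_genericParameters {a b q : ℂ} (ha : a ≠ 0) (hb : b ≠ 0) (hq : q ≠ 0) (p : ℂ) :
    (a, b, p) ∈ closure (genericParameters q) := by
  have key : ∀ p ≠ 0, (a, b, p) ∈ closure (genericParameters q) := by
    intro p hp0
    have hK : a / (b * q) ≠ 0 := by positivity
    set K := a / (b * q) with hKdef
    set Γ : Set ℂ := Set.range fun x : ℤ × ℤ => q ^ x.1 * p ^ x.2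
    have hΓ : Γ.Countable := Set.countable_range _
    have hΓ' : ∀ z : ℂ, z ∉ Γ → ∀ i j : ℤ, z ≠ q ^ i * p ^ j := fun z hz i j h => hz ⟨(i, j), h.symm⟩
    -- the monomials in `b` and `K` that have to be generic scale with nonzero powers of `u` along
    -- `u ↦ (a u⁴, b u)`, that is `K ↦ K u³`
    obtain ⟨C, hC, hCu⟩ : ∃ C : Set ℂ, C.Countable ∧ ∀ u ∉ C, u ≠ 0 ∧ u ^ 16 * (b * K) ^ 4 ∉ Γ
        ∧ u ^ 12 * K ^ 4 ∉ Γ ∧ u ^ 40 * (b * K ^ 3) ^ 4 ∉ Γ ∧ u ^ 8 * (K / b) ^ 4 ∉ Γ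
        ∧ u ^ 4 * b ^ 4 ∉ Γ := by
      refine ⟨_, (Set.countable_singleton (0 : ℂ)).union
        ((countable_setOf_pow_mul_mem hΓ (c := (b * K) ^ 4) (m := 16) (by positivity)
          (by norm_num)).union
        ((countable_setOf_pow_mul_mem hΓ (c := K ^ 4) (m := 12) (by positivity)
          (by norm_num)).union
        ((countable_setOf_pow_mul_mem hΓ (c := (b * K ^ 3) ^ 4) (m := 40) (by positivity)
          (by norm_num)).union
        ((countable_setOf_pow_mul_mem hΓ (c := (K / b) ^ 4) (m := 8) (by positivity)
          (by norm_num)).union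
        (countable_setOf_pow_mul_mem hΓ (c := b ^ 4) (m := 4) (by positivity)
          (by norm_num)))))), fun u hu => ?_⟩
      simpa only [Set.mem_union, Set.mem_singleton_iff, Set.mem_ofPred_eq, not_or] using hu
    have hne := mem_closure_iff_nhdsWithin_neBot.1 (hC.dense_compl ℂ 1)
    have ht : Tendsto (fun u : ℂ => (a * u ^ 4, b * u, p)) (𝓝[Cᶜ] 1) (𝓝 (a, b, p)) := by
      have : ContinuousAt (fun u : ℂ => (a * u ^ 4, b * u, p)) 1 := by fun_prop
      have hle : 𝓝[Cᶜ] (1 : ℂ) ≤ 𝓝 1 := inf_le_left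
      simpa only [one_pow, mul_one] using this.tendsto.mono_left hle
    refine mem_closure_of_tendsto ht ?_
    filter_upwards [self_mem_nhdsWithin] with u hu
    obtain ⟨h0, h1, h2, h3, h4, h5⟩ := hCu u hu
    refine ⟨hp0, mul_ne_zero ha (pow_ne_zero 4 h0), mul_ne_zero hb h0, K * u ^ 3, ?_, ?_, ?_, ?_, ?_, ?_⟩
    · simp only [hKdef]
      field_simp
    · intro i j h
      exact hΓ' _ h1 i j (by rw [← h]; ring)
    · intro i j h
      exact hΓ' _ h2 i j (by rw [← h]; ring)
    · intro i j h
      exact hΓ' _ h3 i j (by rw [← h]; ring)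
    · intro i j h
      refine hΓ' _ h4 (-i) (-j) ?_
      rw [zpow_neg, zpow_neg, ← mul_inv, ← h]
      simp only
      field_simp
    · intro i j h
      exact hΓ' _ h5 i j (by rw [← h]; ring)
  rcases eq_or_ne p 0 with rfl | hp0
  · have ht : Tendsto (fun t : ℂ => (a, b, t)) (𝓝[≠] 0) (𝓝 (a, b, 0)) := by
      have : ContinuousAt (fun t : ℂ => (a, b, t)) 0 := by fun_prop
      exact this.tendsto.mono_left inf_le_left
    refine isClosed_closure.mem_of_tendsto ht ?_
    filter_upwards [self_mem_nhdsWithin] with t ht using key t ht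
  · exact key p hp0

theorem continuousAt_leftSide {n : ℕ} {a b q p : ℂ} (ha : a ≠ 0) (hb : b ≠ 0) (hq : q ≠ 0)
    (hp : ‖p‖ < 1) (hL₁ : theta a (p ^ 2) ≠ 0)
    (hL₂ : thetaPoch (q ^ 2) (q ^ 2) (p ^ 2) n ≠ 0)
    (hL₃ : thetaPoch (b ^ 2 * q ^ (4 - 2 * (n : ℤ)) / a) (q ^ 2) (p ^ 2) n ≠ 0)
    (hL₄ : thetaPoch (a * q ^ (2 * n + 2)) (q ^ 2) (p ^ 2) n ≠ 0)
    (hL₅ : thetaPoch (a ^ 2 / b ^ 2) (q ^ 2) (p ^ 2) n ≠ 0)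
    (hL₆ : thetaPoch (b ^ 2 * q ^ 2) (q ^ 2) (p ^ 4) (2 * n) ≠ 0)
    (hL₇ : thetaPoch (-a / b) q p (2 * n) ≠ 0) :
    ContinuousAt (fun v : ℂ × ℂ × ℂ => leftSide n q v.1 v.2.1 v.2.2) (a, b, p) := by
  have hz : ∀ i : ℤ, q ^ i ≠ 0 := fun i => zpow_ne_zero i hq
  have hpow : ∀ m : ℕ, m ≠ 0 → ‖p ^ m‖ < 1 := fun m hm => by
    rw [norm_pow]; exact pow_lt_one₀ (norm_nonneg p) hp hm
  have c1 : ContinuousAt (fun v : ℂ × ℂ × ℂ => v.1) (a, b, p) := by fun_prop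
  have c2 : ContinuousAt (fun v : ℂ × ℂ × ℂ => v.2.1) (a, b, p) := by fun_prop
  have c3 : ContinuousAt (fun v : ℂ × ℂ × ℂ => v.2.2) (a, b, p) := by fun_prop
  have T : ∀ {f : ℂ × ℂ × ℂ → ℂ}, ContinuousAt f (a, b, p) → f (a, b, p) ≠ 0 → ∀ {Q : ℂ}, Q ≠ 0 →
      ∀ {m : ℕ}, m ≠ 0 → ∀ k : ℕ,
      ContinuousAt (fun v : ℂ × ℂ × ℂ => thetaPoch (f v) Q (v.2.2 ^ m) k) (a, b, p) :=
    fun hf hf0 _ hQ _ hm k => continuousAt_thetaPoch hQ hf (c3.pow _) (hpow _ hm) hf0 k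
  have T1 : ∀ {f : ℂ × ℂ × ℂ → ℂ}, ContinuousAt f (a, b, p) → f (a, b, p) ≠ 0 → ∀ k : ℕ,
      ContinuousAt (fun v : ℂ × ℂ × ℂ => thetaPoch (f v) q v.2.2 k) (a, b, p) :=
    fun hf hf0 k => continuousAt_thetaPoch hq hf c3 hp hf0 k
  have hq2 : q ^ 2 ≠ 0 := pow_ne_zero 2 hq
  have d : ContinuousAt (fun v : ℂ × ℂ × ℂ => v.1 ^ 2 / v.2.1 ^ 2) (a, b, p) :=
    (c1.pow 2).div (c2.pow 2) (pow_ne_zero 2 hb)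
  have d0 : a ^ 2 / b ^ 2 ≠ 0 := by positivity
  unfold leftSide
  refine tendsto_finsetSum _ fun j hj => ?_
  have hj' : j ≤ n := Nat.lt_succ_iff.1 (Finset.mem_range.1 hj)
  refine ContinuousAt.mul (ContinuousAt.div (.mul (.mul (.mul ?_ (.mul (.mul (.mul ?_ ?_) ?_) ?_)) ?_)
    ?_) (.mul (.mul (.mul ?_ (.mul (.mul (.mul ?_ ?_) ?_) ?_)) ?_) ?_) ?_) ?_
  · exact continuousAt_theta (c1.mul_const _) (c3.pow 2) (hpow 2 two_ne_zero)
      (mul_ne_zero ha (pow_ne_zero _ hq))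
  · exact T c1 ha hq2 two_ne_zero j
  · exact T (((c1.pow 2).mul_const _).div (c2.pow 2) (pow_ne_zero 2 hb))
      (div_ne_zero (mul_ne_zero (pow_ne_zero 2 ha) (hz _)) (pow_ne_zero 2 hb)) hq2 two_ne_zero j
  · exact T continuousAt_const (hz _) hq2 two_ne_zero j
  · exact T (((c2.pow 2).mul_const _).div c1 ha)
      (div_ne_zero (mul_ne_zero (pow_ne_zero 2 hb) hq2) ha) hq2 two_ne_zero j
  · exact T d d0 hq2 four_ne_zero _
  · exact T1 (c2.neg.mul_const _) (mul_ne_zero (neg_ne_zero.2 hb) hq) _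
  · exact continuousAt_theta c1 (c3.pow 2) (hpow 2 two_ne_zero) ha
  · exact T continuousAt_const hq2 hq2 two_ne_zero j
  · exact T (((c2.pow 2).mul_const _).div c1 ha)
      (div_ne_zero (mul_ne_zero (pow_ne_zero 2 hb) (hz _)) ha) hq2 two_ne_zero j
  · exact T (c1.mul_const _) (mul_ne_zero ha (pow_ne_zero _ hq)) hq2 two_ne_zero j
  · exact T d d0 hq2 two_ne_zero j
  · exact T ((c2.pow 2).mul_const _) (mul_ne_zero (pow_ne_zero 2 hb) hq2) hq2 four_ne_zero _
  · exact T1 (c1.neg.div c2 hb) (div_ne_zero (neg_ne_zero.2 ha) hb) _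
  · have l := fun {x Q r : ℂ} => thetaPoch_ne_zero_of_le (x := x) (q := Q) (p := r) hj'
    have l2 := fun {x Q r : ℂ} => thetaPoch_ne_zero_of_le (x := x) (q := Q) (p := r)
      (Nat.mul_le_mul_left 2 hj')
    exact mul_ne_zero (mul_ne_zero (mul_ne_zero hL₁ (mul_ne_zero (mul_ne_zero (mul_ne_zero
      (l hL₂) (l hL₃)) (l hL₄)) (l hL₅))) (l2 hL₆)) (l2 hL₇)
  · exact (((c2.pow 2).mul_const _).div c1 ha).pow j

theorem continuousAt_rightFactor {n : ℕ} {a b q p : ℂ} (ha : a ≠ 0) (hb : b ≠ 0) (hq : q ≠ 0)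
    (hp : ‖p‖ < 1) (hP₁ : theta (-a * q ^ (2 * (n : ℤ) - 1) / b) p ≠ 0)
    (hP₂ : thetaPoch (-a / (b * q)) q p n ≠ 0) (hP₃ : thetaPoch (b * q) q p n ≠ 0)
    (hP₄ : thetaPoch (a / (b ^ 2 * q ^ 2)) (q ^ 2) (p ^ 2) n ≠ 0) :
    ContinuousAt (fun v : ℂ × ℂ × ℂ => rightFactor n q v.1 v.2.1 v.2.2) (a, b, p) := by
  have hz : ∀ i : ℤ, q ^ i ≠ 0 := fun i => zpow_ne_zero i hq
  have hp2 := norm_sq_lt_one hp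
  have c1 : ContinuousAt (fun v : ℂ × ℂ × ℂ => v.1) (a, b, p) := by fun_prop
  have c2 : ContinuousAt (fun v : ℂ × ℂ × ℂ => v.2.1) (a, b, p) := by fun_prop
  have c3 : ContinuousAt (fun v : ℂ × ℂ × ℂ => v.2.2) (a, b, p) := by fun_prop
  have hq2 : q ^ 2 ≠ 0 := pow_ne_zero 2 hq
  have hbq := mul_ne_zero hb hq
  have d : ContinuousAt (fun v : ℂ × ℂ × ℂ => -v.1 / (v.2.1 * q)) (a, b, p) :=
    c1.neg.div (c2.mul_const q) hbq
  have d0 : -a / (b * q) ≠ 0 := div_ne_zero (neg_ne_zero.2 ha) hbq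
  unfold rightFactor
  refine ContinuousAt.mul (ContinuousAt.div (.mul (.mul ?_ (.mul ?_ ?_)) ?_)
    (.mul (.mul ?_ (.mul ?_ ?_)) ?_) ?_) continuousAt_const
  · exact continuousAt_theta d c3 hp d0
  · exact continuousAt_thetaPoch hq continuousAt_const c3 hp (neg_ne_zero.2 hq) n
  · exact continuousAt_thetaPoch hq (c1.div ((c2.pow 2).mul_const q)
      (mul_ne_zero (pow_ne_zero 2 hb) hq)) c3 hp
      (div_ne_zero ha (mul_ne_zero (pow_ne_zero 2 hb) hq)) n
  · exact continuousAt_thetaPoch hq2 (c1.mul_const _) (c3.pow 2) hp2 (mul_ne_zero ha hq2) n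
  · exact continuousAt_theta ((c1.neg.mul_const _).div c2 hb) c3 hp
      (div_ne_zero (mul_ne_zero (neg_ne_zero.2 ha) (hz _)) hb)
  · exact continuousAt_thetaPoch hq d c3 hp d0 n
  · exact continuousAt_thetaPoch hq (c2.mul_const q) c3 hp hbq n
  · exact continuousAt_thetaPoch hq2 (c1.div ((c2.pow 2).mul_const _)
      (mul_ne_zero (pow_ne_zero 2 hb) hq2)) (c3.pow 2) hp2
      (div_ne_zero ha (mul_ne_zero (pow_ne_zero 2 hb) hq2)) n
  · exact mul_ne_zero (mul_ne_zero hP₁ (mul_ne_zero hP₂ hP₃)) hP₄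

theorem continuousAt_rightSum {n : ℕ} {a b q p : ℂ} (ha : a ≠ 0) (hb : b ≠ 0) (hq : q ≠ 0)
    (hp : ‖p‖ < 1) (hR₁ : theta (b ^ 2 * p ^ 2) (p ^ 4) ≠ 0)
    (hR₂ : thetaPoch (b ^ 2 * q ^ (2 - (n : ℤ)) / a) q p n ≠ 0)
    (hR₃ : thetaPoch (b * q ^ (n + 1)) q p n ≠ 0)
    (hR₄ : thetaPoch (q ^ 2) (q ^ 2) (p ^ 4) n ≠ 0)
    (hR₅ : thetaPoch (a ^ 2 * p ^ 2 / b ^ 2) (q ^ 2) (p ^ 4) n ≠ 0) :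
    ContinuousAt (fun v : ℂ × ℂ × ℂ => rightSum n q v.1 v.2.1 v.2.2) (a, b, p) := by
  have hz : ∀ i : ℤ, q ^ i ≠ 0 := fun i => zpow_ne_zero i hq
  have hp4 : ‖p ^ 4‖ < 1 := by
    rw [norm_pow]; exact pow_lt_one₀ (norm_nonneg p) hp four_ne_zero
  have c1 : ContinuousAt (fun v : ℂ × ℂ × ℂ => v.1) (a, b, p) := by fun_prop
  have c2 : ContinuousAt (fun v : ℂ × ℂ × ℂ => v.2.1) (a, b, p) := by fun_prop
  have c3 : ContinuousAt (fun v : ℂ × ℂ × ℂ => v.2.2) (a, b, p) := by fun_prop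
  have hq2 : q ^ 2 ≠ 0 := pow_ne_zero 2 hq
  have hb2 : b ^ 2 ≠ 0 := pow_ne_zero 2 hb
  have ha2 : a ^ 2 ≠ 0 := pow_ne_zero 2 ha
  unfold rightSum
  refine tendsto_finsetSum _ fun k hk => ?_
  have hk' : k ≤ n := Nat.lt_succ_iff.1 (Finset.mem_range.1 hk)
  refine ContinuousAt.mul (ContinuousAt.div (.mul (.mul ?_ (.mul ?_ ?_)) (.mul ?_ ?_))
    (.mul (.mul ?_ (.mul ?_ ?_)) (.mul ?_ ?_)) ?_) continuousAt_const
  · exact continuousAt_theta_mul_sq ((c2.pow 2).mul_const _) c3 hp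
      (mul_ne_zero hb2 (pow_ne_zero _ hq))
  · exact continuousAt_thetaPoch hq ((c1.mul_const _).div c2 hb) c3 hp
      (div_ne_zero (mul_ne_zero ha (hz _)) hb) k
  · exact continuousAt_thetaPoch hq continuousAt_const c3 hp (hz _) k
  · exact continuousAt_thetaPoch_mul_sq hq2 (c2.pow 2) c3 hp hb2 k
  · exact continuousAt_thetaPoch hq2 (((c2.pow 4).mul_const _).div (c1.pow 2) ha2) (c3.pow 4) hp4
      (div_ne_zero (mul_ne_zero (pow_ne_zero 4 hb) hq2) ha2) k
  · exact continuousAt_theta_mul_sq (c2.pow 2) c3 hp hb2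
  · exact continuousAt_thetaPoch hq (((c2.pow 2).mul_const _).div c1 ha) c3 hp
      (div_ne_zero (mul_ne_zero hb2 (hz _)) ha) k
  · exact continuousAt_thetaPoch hq (c2.mul_const _) c3 hp (mul_ne_zero hb (pow_ne_zero _ hq)) k
  · exact continuousAt_thetaPoch hq2 continuousAt_const (c3.pow 4) hp4 hq2 k
  · simp only [mul_div_right_comm]
    exact continuousAt_thetaPoch_mul_sq hq2 ((c1.pow 2).div (c2.pow 2) hb2) c3 hp
      (div_ne_zero ha2 hb2) k
  · have l := fun {x Q r : ℂ} => thetaPoch_ne_zero_of_le (x := x) (q := Q) (p := r) hk'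
    exact mul_ne_zero (mul_ne_zero hR₁ (mul_ne_zero (l hR₂) (l hR₃)))
      (mul_ne_zero (l hR₄) (l hR₅))

theorem mainTheorem9 (n : ℕ) (a b q p : ℂ)
    (ha : a ≠ 0) (hb : b ≠ 0) (hq : q ≠ 0) (hp : ‖p‖ < 1)
    -- the denominators of the sum on the left-hand side do not vanish
    (hL₁ : theta a (p ^ 2) ≠ 0)
    (hL₂ : thetaPoch (q ^ 2) (q ^ 2) (p ^ 2) n ≠ 0)
    (hL₃ : thetaPoch (b ^ 2 * q ^ (4 - 2 * (n : ℤ)) / a) (q ^ 2) (p ^ 2) n ≠ 0)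
    (hL₄ : thetaPoch (a * q ^ (2 * n + 2)) (q ^ 2) (p ^ 2) n ≠ 0)
    (hL₅ : thetaPoch (a ^ 2 / b ^ 2) (q ^ 2) (p ^ 2) n ≠ 0)
    (hL₆ : thetaPoch (b ^ 2 * q ^ 2) (q ^ 2) (p ^ 4) (2 * n) ≠ 0)
    (hL₇ : thetaPoch (-a / b) q p (2 * n) ≠ 0)
    -- the denominators of the product on the right-hand side do not vanish
    (hP₁ : theta (-a * q ^ (2 * (n : ℤ) - 1) / b) p ≠ 0)
    (hP₂ : thetaPoch (-a / (b * q)) q p n ≠ 0)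
    (hP₃ : thetaPoch (b * q) q p n ≠ 0)
    (hP₄ : thetaPoch (a / (b ^ 2 * q ^ 2)) (q ^ 2) (p ^ 2) n ≠ 0)
    -- the denominators of the sum on the right-hand side do not vanish
    (hR₁ : theta (b ^ 2 * p ^ 2) (p ^ 4) ≠ 0)
    (hR₂ : thetaPoch (b ^ 2 * q ^ (2 - (n : ℤ)) / a) q p n ≠ 0)
    (hR₃ : thetaPoch (b * q ^ (n + 1)) q p n ≠ 0)
    (hR₄ : thetaPoch (q ^ 2) (q ^ 2) (p ^ 4) n ≠ 0)
    (hR₅ : thetaPoch (a ^ 2 * p ^ 2 / b ^ 2) (q ^ 2) (p ^ 4) n ≠ 0) :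
    ∑ j ∈ Finset.range (n + 1),
      (theta (a * q ^ (4 * j)) (p ^ 2)
          * (thetaPoch a (q ^ 2) (p ^ 2) j
            * thetaPoch (a ^ 2 * q ^ (2 * (n : ℤ) - 2) / b ^ 2) (q ^ 2) (p ^ 2) j
            * thetaPoch (q ^ (-2 * (n : ℤ))) (q ^ 2) (p ^ 2) j
            * thetaPoch (b ^ 2 * q ^ 2 / a) (q ^ 2) (p ^ 2) j)
          * thetaPoch (a ^ 2 / b ^ 2) (q ^ 2) (p ^ 4) (2 * j)
          * thetaPoch (-b * q) q p (2 * j))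
        / (theta a (p ^ 2)
          * (thetaPoch (q ^ 2) (q ^ 2) (p ^ 2) j
            * thetaPoch (b ^ 2 * q ^ (4 - 2 * (n : ℤ)) / a) (q ^ 2) (p ^ 2) j
            * thetaPoch (a * q ^ (2 * n + 2)) (q ^ 2) (p ^ 2) j
            * thetaPoch (a ^ 2 / b ^ 2) (q ^ 2) (p ^ 2) j)
          * thetaPoch (b ^ 2 * q ^ 2) (q ^ 2) (p ^ 4) (2 * j)
          * thetaPoch (-a / b) q p (2 * j))
        * (b ^ 2 * q ^ 3 / a) ^ j
    = (theta (-a / (b * q)) p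
          * (thetaPoch (-q) q p n * thetaPoch (a / (b ^ 2 * q)) q p n)
          * thetaPoch (a * q ^ 2) (q ^ 2) (p ^ 2) n)
        / (theta (-a * q ^ (2 * (n : ℤ) - 1) / b) p
          * (thetaPoch (-a / (b * q)) q p n * thetaPoch (b * q) q p n)
          * thetaPoch (a / (b ^ 2 * q ^ 2)) (q ^ 2) (p ^ 2) n)
        * q ^ (-(n : ℤ))
        * ∑ k ∈ Finset.range (n + 1),
          (theta (b ^ 2 * q ^ (4 * k) * p ^ 2) (p ^ 4)
              * (thetaPoch (a * q ^ ((n : ℤ) - 1) / b) q p k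
                * thetaPoch (q ^ (-(n : ℤ))) q p k)
              * (thetaPoch (b ^ 2 * p ^ 2) (q ^ 2) (p ^ 4) k
                * thetaPoch (b ^ 4 * q ^ 2 / a ^ 2) (q ^ 2) (p ^ 4) k))
            / (theta (b ^ 2 * p ^ 2) (p ^ 4)
              * (thetaPoch (b ^ 2 * q ^ (2 - (n : ℤ)) / a) q p k
                * thetaPoch (b * q ^ (n + 1)) q p k)
              * (thetaPoch (q ^ 2) (q ^ 2) (p ^ 4) k
                * thetaPoch (a ^ 2 * p ^ 2 / b ^ 2) (q ^ 2) (p ^ 4) k))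
            * q ^ (2 * k) := by
  have hcL := continuousAt_leftSide ha hb hq hp hL₁ hL₂ hL₃ hL₄ hL₅ hL₆ hL₇
  have hcR := (continuousAt_rightFactor ha hb hq hp hP₁ hP₂ hP₃ hP₄).mul
    (continuousAt_rightSum ha hb hq hp hR₁ hR₂ hR₃ hR₄ hR₅)
  have hne := mem_closure_iff_nhdsWithin_neBot.1 (mem_closure_genericParameters ha hb hq p)
  have hle : 𝓝[genericParameters q] (a, b, p) ≤ 𝓝 (a, b, p) := inf_le_left
  have c3 : ContinuousAt (fun v : ℂ × ℂ × ℂ => v.2.2) (a, b, p) := by fun_prop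
  have hq2 : q ^ 2 ≠ 0 := pow_ne_zero 2 hq
  have e1 : ∀ᶠ v in 𝓝 (a, b, p), ‖v.2.2‖ < 1 := c3.norm.eventually (gt_mem_nhds hp)
  have e2 : ∀ᶠ v in 𝓝 (a, b, p), thetaPoch (q ^ 2) (q ^ 2) (v.2.2 ^ 2) n ≠ 0 :=
    (continuousAt_thetaPoch hq2 continuousAt_const (c3.pow 2) (norm_sq_lt_one hp)
      hq2 n).eventually_ne hL₂
  refine tendsto_nhds_unique_of_eventuallyEq (hcL.tendsto.mono_left hle)
    (hcR.tendsto.mono_left hle) ?_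
  filter_upwards [hle e1, hle e2, self_mem_nhdsWithin] with v hv1 hv2 hv
  obtain ⟨hp0, hva, hvb, K, hK, h1, h2, h3, h4, h5⟩ := hv
  have hK0 : K ≠ 0 := by
    rintro rfl
    simp [hva] at hK
  have key := leftSide_eq_rightFactor_mul_rightSum_of_generic hv1 hp0 hvb hK0 hq h1 h2 h3 h4 h5 hv2
  rw [← hK] at key
  exact key
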